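/- **Theorem (Disconnected is Schottky).** Let $z\in\mathbb{C}$ with $0<|z|<1$, let $f,g:\mathbb{C}\to\mathbb{C}$ be the contracting similarities $f(x)=zx$ and $g(x)=z(x-1)+1$, and let $G_z$ be the semigroup generated by $f$ and $g$ under composition. Let the limit set $\Lambda_z$ be the closure of the set of fixed points of elements of $G_z$. Call a closed topological disk $D\subset\mathbb{C}$, bounded by an embedded loop $\gamma$, *good* for $G_z$ if $f(D)$ and $g(D)$ are disjoint and both are contained in the interior of $D$; call $G_z$ *Schottky* if there is a good disk for $G_z$. Then $\Lambda_z$ is disconnected if and only if $G_z$ is Schottky. Moreover, every good disk for $G_z$ contains $\Lambda_z$. -/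

import Mathlib

namespace SchottkySimilarity

/-- The similarity `f : x ↦ z x` of the complex plane (center `0`, dilation `z`). -/
def f (z : ℂ) : Function.End ℂ := fun x : ℂ => z * x

/-- The similarity `g : x ↦ z (x - 1) + 1` of the complex plane (center `1`, dilation `z`). -/
def g (z : ℂ) : Function.End ℂ := fun x : ℂ => z * (x - 1) + 1

/-- The set `{f, g}` of the two generators. -/
def generators (z : ℂ) : Set (Function.End ℂ) := {f z, g z}

/-- The semigroup `G_z` generated by `f` and `g` under composition. (The identity is not
adjoined: elements are the compositions of a positive number of generators.) -/
def G (z : ℂ) : Subsemigroup (Function.End ℂ) := Subsemigroup.closure (generators z)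

/-- The limit set of a semigroup of self-maps of the plane: the closure of the set of
fixed points of its elements. -/
def limitSet (H : Subsemigroup (Function.End ℂ)) : Set ℂ :=
  closure {x : ℂ | ∃ φ ∈ H, φ x = x}

/-- `γ` is an embedded loop in the plane and bounds the closed topological disk `D`: the set
`D` is homeomorphic to the closed unit disk, and its boundary is the image of `γ`. -/
structure BoundsClosedDisk (γ : Circle → ℂ) (D : Set ℂ) : Prop where
  continuous_loop : Continuous γ
  injective_loop : Function.Injective γ
  homeomorphic_disk : Nonempty (D ≃ₜ Metric.closedBall (0 : ℂ) 1)
  frontier_eq : frontier D = Set.range γ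

/-- `D` is a good disk for the semigroup generated by `S`: it is a closed topological disk
bounded by an embedded loop, and the elements of `S` take `D` to pairwise disjoint
subsets (which are again disks when the elements of `S` are similarities) of its interior. -/
def IsGoodDisk (S : Set (Function.End ℂ)) (D : Set ℂ) : Prop :=
  (∃ γ : Circle → ℂ, BoundsClosedDisk γ D) ∧
    (∀ s ∈ S, s '' D ⊆ interior D) ∧
    (∀ s ∈ S, ∀ t ∈ S, s ≠ t → Disjoint (s '' D) (t '' D))

/-- The semigroup generated by `S` is a Schottky semigroup: it has a good disk. -/
def IsSchottky (S : Set (Function.End ℂ)) : Prop :=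
  ∃ D : Set ℂ, IsGoodDisk S D

end SchottkySimilarity

/-! Write Λ for the limit set. It is compact, contains `0`, and is the union of f(Λ) and g(Λ)
(`limitSet_eq_union`). A good disk contains Λ because it is closed and forward invariant; f(Λ) and
g(Λ) are then disjoint nonempty closed sets, so Λ is disconnected.

Conversely, let Λ be disconnected. The thickening of Λ of radius s is connected once 2s is at least
the distance d between f(Λ) and g(Λ) (`isPreconnected_cthickening_limitSet`); if d were 0, every
thickening and hence Λ itself would be connected, so d > 0. If moreover 2‖z‖s < d, then f and g send
the thickening to disjoint sets. Filling in holes keeps them disjoint, because two bounded sets that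
are translates of each other cannot be nested (`disjoint_fill_of_translate`). Thus any s from d/2 up
to, but not including, d/(2‖z‖) gives a connected set without holes that has the required dynamics,
except that it need not be a disk.

To get a disk, take the union U of these filled thickenings for s in [d/2, r), where d/2 < r <
d/(2‖z‖). It is a bounded domain without holes, and both generators map it into the filled
d/2-thickening K. It remains to place a disk between K and U (`exists_boundsClosedDisk_between`).
This follows from an approximate Riemann map: Runge's theorem gives primitives, hence square roots
of nonvanishing functions, and Koebe's square root trick gives an injective map of U into the unit
disk whose image covers a prescribed disk of radius ρ < 1. The preimage of that disk is the good
disk. -/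

open Set Metric Filter Topology Bornology

namespace SchottkySimilarity

/-! ### Filling in the holes of a set -/

section Fill

variable {E : Type*} [NormedAddCommGroup E]

/-- The union of a set with the bounded components of its complement. -/
def fill (S : Set E) : Set E := {x | IsBounded (connectedComponentIn Sᶜ x)}

theorem subset_fill (S : Set E) : S ⊆ fill S := fun x hx => by
  simp [fill, connectedComponentIn_eq_empty (show x ∉ Sᶜ from not_not.2 hx)]

theorem fill_mono {S T : Set E} (h : S ⊆ T) : fill S ⊆ fill T := fun _ hx =>
  IsBounded.subset hx (connectedComponentIn_mono _ (compl_subset_compl.2 h))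

theorem connectedComponentIn_subset_compl_fill {S : Set E} {x : E} (hx : x ∉ fill S) :
    connectedComponentIn Sᶜ x ⊆ (fill S)ᶜ := fun y hy hy' => hx (by
  have h : IsBounded (connectedComponentIn Sᶜ y) := hy'
  rwa [← connectedComponentIn_eq hy] at h)

theorem connectedComponentIn_subset_fill {S : Set E} {x : E} (hx : x ∈ fill S) :
    connectedComponentIn Sᶜ x ⊆ fill S := fun y hy => by
  have h : IsBounded (connectedComponentIn Sᶜ x) := hx
  rwa [connectedComponentIn_eq hy] at h

/-- An unbounded component of the complement of `S` misses `fill S` entirely, so it survives in the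
complement of `fill S`. -/
theorem fill_fill (S : Set E) : fill (fill S) = fill S := by
  refine Subset.antisymm (fun x hx => ?_) (subset_fill _)
  by_contra hxS
  have hxc : x ∈ Sᶜ := fun h => hxS (subset_fill S h)
  exact hxS (IsBounded.subset hx
    (isPreconnected_connectedComponentIn.subset_connectedComponentIn
      (mem_connectedComponentIn hxc) (connectedComponentIn_subset_compl_fill hxS)))

theorem isBounded_image_homeomorph [ProperSpace E] (e : E ≃ₜ E) {B : Set E} :
    IsBounded (e '' B) ↔ IsBounded B := by
  have h : ∀ (e : E ≃ₜ E) (B : Set E), IsBounded B → IsBounded (e '' B) := fun e B hB =>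
    (hB.isCompact_closure.image e.continuous).isBounded.subset (image_mono subset_closure)
  refine ⟨fun hB => ?_, h e B⟩
  simpa [image_image] using h e.symm _ hB

theorem image_fill [ProperSpace E] (e : E ≃ₜ E) (S : Set E) : e '' fill S = fill (e '' S) := by
  ext y
  obtain ⟨x, rfl⟩ := e.surjective y
  rw [e.injective.mem_set_image]
  by_cases hx : x ∈ S
  · exact iff_of_true (subset_fill S hx) (subset_fill _ (mem_image_of_mem e hx))
  · change IsBounded _ ↔ IsBounded _
    rw [← image_compl_eq e.bijective, ← e.image_connectedComponentIn (show x ∈ Sᶜ from hx),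
      isBounded_image_homeomorph]

variable [NormedSpace ℝ E]

theorem fill_empty [Nontrivial E] : fill (∅ : Set E) = ∅ := by
  ext x
  simp only [fill, compl_empty, mem_ofPred_eq, mem_empty_iff_false, iff_false,
    connectedComponentIn_univ, PreconnectedSpace.connectedComponent_eq_univ]
  exact NormedSpace.unbounded_univ ℝ E

theorem isClosed_fill {S : Set E} (hS : IsClosed S) : IsClosed (fill S) := by
  rw [← isOpen_compl_iff, isOpen_iff_mem_nhds]
  intro x hx
  have hxc : x ∈ Sᶜ := fun h => hx (subset_fill S h)
  exact mem_of_superset (hS.isOpen_compl.connectedComponentIn.mem_nhds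
    (mem_connectedComponentIn hxc)) (connectedComponentIn_subset_compl_fill hx)

/-- From a point outside a ball containing `S`, the radial ray to infinity avoids `S`, so the
component of such a point is unbounded. -/
theorem isBounded_fill [Nontrivial E] {S : Set E} (hS : IsBounded S) : IsBounded (fill S) := by
  obtain ⟨R, hR⟩ := hS.subset_closedBall (0 : E)
  refine (isBounded_closedBall (x := (0 : E)) (r := max R 0)).subset fun x hx => ?_
  by_contra hxR
  simp only [mem_closedBall, dist_zero_right, not_le, max_lt_iff] at hxR
  have hray : (fun t : ℝ => t • x) '' Ici 1 ⊆ Sᶜ := by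
    rintro _ ⟨t, ht, rfl⟩ hS'
    have := hR hS'
    simp only [mem_closedBall, dist_zero_right, norm_smul, Real.norm_eq_abs] at this
    have h1 : (1 : ℝ) ≤ |t| := (mem_Ici.1 ht).trans (le_abs_self t)
    nlinarith [norm_nonneg x]
  have hpre : IsPreconnected ((fun t : ℝ => t • x) '' Ici 1) :=
    isPreconnected_Ici.image _ (by fun_prop)
  have hb : IsBounded ((fun t : ℝ => t • x) '' Ici 1) :=
    IsBounded.subset hx (hpre.subset_connectedComponentIn ⟨1, by simp, by simp⟩ hray)
  obtain ⟨C, hC⟩ := hb.exists_norm_le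
  have h := hC _ ⟨max 1 ((C + 1) / ‖x‖), by simp, rfl⟩
  rw [norm_smul, Real.norm_eq_abs, abs_of_pos (by positivity)] at h
  have h2 : (C + 1) / ‖x‖ * ‖x‖ ≤ max 1 ((C + 1) / ‖x‖) * ‖x‖ :=
    mul_le_mul_of_nonneg_right (le_max_right _ _) (norm_nonneg x)
  rw [div_mul_cancel₀ _ hxR.2.ne'] at h2
  linarith

theorem isCompact_fill [ProperSpace E] [Nontrivial E] {S : Set E} (hS : IsCompact S) :
    IsCompact (fill S) :=
  isCompact_of_isClosed_isBounded (isClosed_fill hS.isClosed) (isBounded_fill hS.isBounded)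

/-- A bounded component of the complement of a closed set has a boundary point, and it belongs to
the set. -/
theorem exists_mem_closure_connectedComponentIn [Nontrivial E] {S : Set E} (hS : IsClosed S)
    {x : E} (hx : x ∈ fill S) (hxS : x ∉ S) :
    ∃ y ∈ S, y ∈ closure (connectedComponentIn Sᶜ x) := by
  have hxc : x ∈ connectedComponentIn Sᶜ x := mem_connectedComponentIn hxS
  have hne : connectedComponentIn Sᶜ x ≠ univ := fun h =>
    NormedSpace.unbounded_univ ℝ E (h ▸ hx)
  obtain ⟨y, hy⟩ := nonempty_frontier_iff.2 ⟨⟨x, hxc⟩, hne⟩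
  refine ⟨y, ?_, hy.1⟩
  by_contra hyS
  have hpre : IsPreconnected (insert y (connectedComponentIn Sᶜ x)) :=
    isPreconnected_connectedComponentIn.subset_closure (subset_insert _ _)
      (insert_subset hy.1 subset_closure)
  have := hpre.subset_connectedComponentIn (mem_insert_of_mem _ hxc)
    (insert_subset hyS (connectedComponentIn_subset _ _)) (mem_insert y _)
  rw [hS.isOpen_compl.connectedComponentIn.frontier_eq] at hy
  exact hy.2 this

/-- Every hole has a point of `S` in its closure, so adjoining it to `S` preserves connectedness. -/
theorem isPreconnected_fill [Nontrivial E] {S : Set E} (hS : IsClosed S) (hc : IsPreconnected S) :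
    IsPreconnected (fill S) := by
  rcases S.eq_empty_or_nonempty with rfl | ⟨p, hp⟩
  · rw [fill_empty]; exact isPreconnected_empty
  refine isPreconnected_of_forall p fun x hx => ?_
  by_cases hxS : x ∈ S
  · exact ⟨S, subset_fill S, hp, hxS, hc⟩
  obtain ⟨y, hyS, hy⟩ := exists_mem_closure_connectedComponentIn hS hx hxS
  have hpre : IsPreconnected (insert y (connectedComponentIn Sᶜ x)) :=
    isPreconnected_connectedComponentIn.subset_closure (subset_insert _ _)
      (insert_subset hy subset_closure)
  exact ⟨S ∪ insert y (connectedComponentIn Sᶜ x),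
    union_subset (subset_fill S)
      (insert_subset (subset_fill S hyS) (connectedComponentIn_subset_fill hx)),
    Or.inl hp, Or.inr (mem_insert_of_mem _ (mem_connectedComponentIn hxS)),
    hc.union y hyS (mem_insert _ _) hpre⟩

theorem fill_subset_interior_fill {S T : Set E} (hS : IsClosed S) (h : S ⊆ interior T) :
    fill S ⊆ interior (fill T) := by
  intro x hx
  by_cases hxS : x ∈ S
  · exact interior_mono (subset_fill T) (h hxS)
  · exact interior_maximal ((connectedComponentIn_subset_fill hx).trans
      (fill_mono (h.trans interior_subset))) hS.isOpen_compl.connectedComponentIn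
      (mem_connectedComponentIn hxS)

/-- Two disjoint connected compact sets that are translates of each other are not nested, so their
fillings are disjoint. -/
theorem disjoint_fill_of_translate [ProperSpace E] [Nontrivial E] {A : Set E} {c : E}
    (hA : IsCompact A) (hAc : IsConnected A) (hd : Disjoint A ((c + ·) '' A)) :
    Disjoint (fill A) (fill ((c + ·) '' A)) := by
  set B : Set E := (c + ·) '' A with hB
  have hBcomp : IsCompact B := hA.image (by fun_prop)
  have hBconn : IsConnected B := hAc.image _ (by fun_prop)
  have htr : ∀ (d : E) (X : Set E), (d + ·) '' fill X = fill ((d + ·) '' X) := fun d X =>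
    image_fill (Homeomorph.addLeft d) X
  -- a nonempty bounded set is not invariant under a nontrivial translation
  have hinv : ∀ (d : E) (X : Set E), d ≠ 0 → X.Nonempty → IsBounded X →
      ¬ (d + ·) '' X ⊆ X := by
    rintro d X hd0 ⟨x, hx⟩ hX hsub
    obtain ⟨C, hC⟩ := hX.exists_norm_le
    have hn : ∀ n : ℕ, (n : ℝ) • d + x ∈ X := by
      intro n
      induction n with
      | zero => simpa using hx
      | succ n ih =>
        have := hsub (mem_image_of_mem _ ih)
        convert this using 1
        push_cast
        module
    obtain ⟨n, hn'⟩ := exists_nat_gt ((C + ‖x‖) / ‖d‖)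
    have h1 := hC _ (hn n)
    have h2 := norm_sub_le ((n : ℝ) • d + x) x
    rw [add_sub_cancel_right, norm_smul, Real.norm_natCast] at h2
    rw [div_lt_iff₀ (norm_pos_iff.2 hd0)] at hn'
    linarith
  have hc0 : c ≠ 0 := by
    rintro rfl
    obtain ⟨a, ha⟩ := hAc.nonempty
    exact hd.le_bot ⟨ha, a, ha, by simp⟩
  -- A connected set disjoint from `Y` that meets a hole of `Y` lies in that hole.
  have key : ∀ X Y : Set E, IsPreconnected X → Disjoint X Y → ¬ X ⊆ fill Y →
      Disjoint X (fill Y) := by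
    intro X Y hX hXY hns
    obtain ⟨p, hpX, hp⟩ := not_subset.1 hns
    refine disjoint_left.2 fun x hx hxY => hp ?_
    have := hX.subset_connectedComponentIn hx (subset_compl_iff_disjoint_right.2 hXY)
    exact connectedComponentIn_subset_fill hxY (this hpX)
  -- Nesting would make `fill A` invariant under translation by `-c`, contradicting boundedness;
  -- `hBA` is the same with `c`.
  have hAB : ¬ A ⊆ fill B := fun h => by
    have h1 := fill_mono h
    rw [fill_fill, hB, ← htr] at h1
    refine hinv (-c) (fill A) (neg_ne_zero.2 hc0) (hAc.nonempty.mono (subset_fill A))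
      (isBounded_fill hA.isBounded) ?_
    rintro _ ⟨x, hx, rfl⟩
    obtain ⟨y, hy, rfl⟩ := h1 hx
    simpa using hy
  have hBA : ¬ B ⊆ fill A := fun h => by
    have h1 := fill_mono h
    rw [fill_fill, hB, ← htr] at h1
    exact hinv c (fill A) hc0 (hAc.nonempty.mono (subset_fill A)) (isBounded_fill hA.isBounded) h1
  have hA' := key A B hAc.isPreconnected hd hAB
  have hB' := key B A hBconn.isPreconnected hd.symm hBA
  -- A common point would lie in a hole of `A` contained in a hole of `B`. The closure of the former
  -- meets `A`, which would put a point of `A` in `fill B`.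
  refine disjoint_left.2 fun x hxA hxB => ?_
  have hx1 : x ∉ A := fun h => hA'.le_bot ⟨h, hxB⟩
  have hle : connectedComponentIn Aᶜ x ⊆ connectedComponentIn Bᶜ x :=
    isPreconnected_connectedComponentIn.subset_connectedComponentIn
      (mem_connectedComponentIn hx1) fun y hy hyB =>
        hB'.le_bot ⟨hyB, connectedComponentIn_subset_fill hxA hy⟩
  obtain ⟨y, hyA, hy⟩ := exists_mem_closure_connectedComponentIn hA.isClosed hxA hx1
  have := closure_minimal (hle.trans (connectedComponentIn_subset_fill hxB))
    (isClosed_fill hBcomp.isClosed) hy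
  exact hA'.le_bot ⟨hyA, this⟩

end Fill

/-! ### Approximation of holomorphic functions by polynomials -/

section Runge

open Complex MeasureTheory intervalIntegral

/-- The Cauchy–Riemann operator `2i ∂/∂z̄`. -/
noncomputable def dbar (k : ℂ → ℂ) (w : ℂ) : ℂ := I * fderiv ℝ k w 1 - fderiv ℝ k w I

theorem dbar_eq_zero {k : ℂ → ℂ} {w : ℂ} (h : DifferentiableAt ℂ k w) : dbar k w = 0 := by
  have h1 : fderiv ℝ k w = (fderiv ℂ k w).restrictScalars ℝ :=
    h.hasFDerivAt.restrictScalars ℝ |>.fderiv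
  have h2 : fderiv ℂ k w I = I * fderiv ℂ k w 1 := by
    simp
  simp [dbar, h1, h2]

theorem dbar_congr {k l : ℂ → ℂ} {w : ℂ} (h : k =ᶠ[𝓝 w] l) : dbar k w = dbar l w := by
  simp [dbar, h.fderiv_eq]

theorem dbar_mul {k l : ℂ → ℂ} {w : ℂ} (hl : DifferentiableAt ℂ l w)
    (hk : DifferentiableAt ℝ k w) : dbar (fun x => l x * k x) w = l w * dbar k w := by
  have h1 : fderiv ℝ l w = (fderiv ℂ l w).restrictScalars ℝ :=
    hl.hasFDerivAt.restrictScalars ℝ |>.fderiv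
  have h2 : fderiv ℂ l w I = I * fderiv ℂ l w 1 := by
    simp
  have h3 := fderiv_fun_mul (hl.restrictScalars ℝ) hk
  simp only [dbar, h3, h1, h2, add_apply, smul_apply,
    ContinuousLinearMap.coe_restrictScalars', smul_eq_mul]
  ring

theorem dbar_sub_const {k : ℂ → ℂ} (c w : ℂ) : dbar (fun x => k x - c) w = dbar k w := by
  simp [dbar, fderiv_sub_const]

theorem continuous_dbar {k : ℂ → ℂ} (hk : ContDiff ℝ 1 k) : Continuous (dbar k) := by
  have := hk.continuous_fderiv one_ne_zero
  unfold dbar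
  fun_prop

/-- The integral of `(w - z)⁻¹` over the boundary of the square `[-B, B] × [-B, B]`. -/
noncomputable def squareIntegral (B : ℝ) (z : ℂ) : ℂ :=
  (∫ x : ℝ in (-B)..B, (x + (-B : ℝ) * I - z)⁻¹) - (∫ x : ℝ in (-B)..B, (x + B * I - z)⁻¹) +
    I * (∫ y : ℝ in (-B)..B, (B + y * I - z)⁻¹) -
    I * (∫ y : ℝ in (-B)..B, ((-B : ℝ) + y * I - z)⁻¹)

/-- Adding the four sides over a common parameter leaves `I` times the integral of the positive
function 4B/(t² + B²). The exact value is never needed, only that it is nonzero. -/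
theorem squareIntegral_zero_ne_zero {B : ℝ} (hB : 0 < B) : squareIntegral B 0 ≠ 0 := by
  have e1 : ∀ t : ℝ, (t : ℂ) + (-B : ℝ) * I ≠ 0 := fun t h => by
    have := congrArg im h; simp at this; exact hB.ne' this
  have e2 : ∀ t : ℝ, (t : ℂ) + B * I ≠ 0 := fun t h => by
    have := congrArg im h; simp at this; exact hB.ne' this
  have e3 : ∀ t : ℝ, (B : ℂ) + t * I ≠ 0 := fun t h => by
    have := congrArg re h; simp at this; exact hB.ne' this
  have e4 : ∀ t : ℝ, ((-B : ℝ) : ℂ) + t * I ≠ 0 := fun t h => by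
    have := congrArg re h; simp at this; exact hB.ne' this
  have i1 : IntervalIntegrable (fun t : ℝ => ((t : ℂ) + (-B : ℝ) * I)⁻¹) volume (-B) B :=
    (Continuous.inv₀ (by fun_prop) e1).intervalIntegrable _ _
  have i2 : IntervalIntegrable (fun t : ℝ => ((t : ℂ) + B * I)⁻¹) volume (-B) B :=
    (Continuous.inv₀ (by fun_prop) e2).intervalIntegrable _ _
  have i3 : IntervalIntegrable (fun t : ℝ => I * ((B : ℂ) + t * I)⁻¹) volume (-B) B :=
    (continuous_const.mul (Continuous.inv₀ (by fun_prop) e3)).intervalIntegrable _ _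
  have i4 : IntervalIntegrable (fun t : ℝ => I * (((-B : ℝ) : ℂ) + t * I)⁻¹) volume (-B) B :=
    (continuous_const.mul (Continuous.inv₀ (by fun_prop) e4)).intervalIntegrable _ _
  have key : squareIntegral B 0 = ((∫ t : ℝ in (-B)..B, 4 * B / (t ^ 2 + B ^ 2) : ℝ) : ℂ) * I := by
    simp only [squareIntegral, sub_zero]
    rw [← intervalIntegral.integral_const_mul, ← intervalIntegral.integral_const_mul,
      ← integral_sub i1 i2, ← integral_add (i1.sub i2) i3,
      ← integral_sub ((i1.sub i2).add i3) i4, ← intervalIntegral.integral_ofReal,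
      ← intervalIntegral.integral_mul_const]
    refine integral_congr fun t _ => ?_
    have h5 : (t : ℂ) ^ 2 + B ^ 2 ≠ 0 := by
      have : t ^ 2 + B ^ 2 ≠ 0 := by positivity
      exact_mod_cast this
    have h1 := e1 t
    have h2 := e2 t
    have h3 := e3 t
    have h4 := e4 t
    push_cast at h1 h4 ⊢
    have f1 : ((t : ℂ) + -B * I)⁻¹ = (t + B * I) / (t ^ 2 + B ^ 2) := by
      rw [inv_eq_iff_eq_inv, inv_div, eq_div_iff h2]; linear_combination -(B : ℂ) ^ 2 * I_sq
    have f2 : ((t : ℂ) + B * I)⁻¹ = (t + -B * I) / (t ^ 2 + B ^ 2) := by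
      rw [inv_eq_iff_eq_inv, inv_div, eq_div_iff h1]; linear_combination -(B : ℂ) ^ 2 * I_sq
    have f3 : ((B : ℂ) + t * I)⁻¹ = (B - t * I) / (t ^ 2 + B ^ 2) := by
      rw [inv_eq_iff_eq_inv, inv_div, eq_div_iff (fun h => h4 (by linear_combination -h))]
      linear_combination -(t : ℂ) ^ 2 * I_sq
    have f4 : (-(B : ℂ) + t * I)⁻¹ = (-B - t * I) / (t ^ 2 + B ^ 2) := by
      rw [inv_eq_iff_eq_inv, inv_div, eq_div_iff (fun h => h3 (by linear_combination -h))]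
      linear_combination -(t : ℂ) ^ 2 * I_sq
    rw [f1, f2, f3, f4]
    ring
  rw [key]
  refine mul_ne_zero (ofReal_ne_zero.2 (ne_of_gt ?_)) I_ne_zero
  refine intervalIntegral_pos_of_pos (Continuous.intervalIntegrable ?_ _ _) (fun t => by positivity)
    (by linarith)
  exact continuous_const.div (by fun_prop) fun t => by positivity

/-- On the boundary, log((w - z)/w) is a single-valued primitive of the difference of the two
integrands: (w - z)/w is real and nonpositive only if z = (1 + s)w with s ≥ 0, which is impossible
for z inside the square. The corner values then cancel. -/
theorem squareIntegral_eq {B : ℝ} {z : ℂ} (hre : |z.re| < B) (him : |z.im| < B) :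
    squareIntegral B z = squareIntegral B 0 := by
  have hB : 0 < B := (abs_nonneg _).trans_lt hre
  -- boundary points of the square
  let bd : Set ℂ := {w | |w.re| = B ∨ |w.im| = B}
  have hz : ∀ w ∈ bd, ∀ s : ℝ, 0 ≤ s → (1 + s) * w ≠ z := by
    rintro w hw s hs rfl
    have h1 : |((1 + s) * w : ℂ).re| = (1 + s) * |w.re| := by
      simp [abs_mul, abs_of_nonneg (show 0 ≤ 1 + s by linarith)]
    have h2 : |((1 + s) * w : ℂ).im| = (1 + s) * |w.im| := by
      simp [abs_mul, abs_of_nonneg (show 0 ≤ 1 + s by linarith)]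
    rw [h1] at hre
    rw [h2] at him
    rcases hw with hw | hw <;> simp only [hw] at hre him <;> nlinarith
  have hw0 : ∀ w ∈ bd, w ≠ 0 := by
    rintro w hw rfl
    rcases hw with hw | hw <;> simp at hw <;> linarith
  have hwz : ∀ w ∈ bd, w - z ≠ 0 := fun w hw h =>
    hz w hw 0 le_rfl (by rw [sub_eq_zero] at h; simp [h])
  have hG : ∀ w ∈ bd, HasDerivAt (fun w => log ((w - z) / w)) ((w - z)⁻¹ - (w - 0)⁻¹) w := by
    intro w hw
    have hsl : (w - z) / w ∈ slitPlane := by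
      rw [mem_slitPlane_iff_not_le_zero]
      intro hle
      rw [Complex.le_def] at hle
      simp only [zero_re, zero_im] at hle
      have h : (w - z) / w = ((((w - z) / w).re : ℝ) : ℂ) := Complex.ext (by simp) (by simpa using hle.2)
      rw [div_eq_iff (hw0 w hw)] at h
      refine hz w hw (-((w - z) / w).re) (by linarith [hle.1]) ?_
      push_cast
      linear_combination h
    have := ((hasDerivAt_id w).sub_const z |>.div (hasDerivAt_id w) (hw0 w hw)).clog hsl
    refine this.congr_deriv ?_
    have h1 := hw0 w hw
    have h2 := hwz w hw
    simp only [id, Pi.div_apply, sub_zero]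
    field_simp
  have hmem1 : ∀ (c : ℝ), |c| = B → ∀ t : ℝ, (t : ℂ) + c * I ∈ bd := fun c hc t => Or.inr (by simpa)
  have hmem2 : ∀ (c : ℝ), |c| = B → ∀ t : ℝ, (c : ℂ) + t * I ∈ bd := fun c hc t => Or.inl (by simpa)
  have ii : ∀ γ : ℝ → ℂ, Continuous γ → (∀ t, γ t ∈ bd) →
      IntervalIntegrable (fun t => (γ t - z)⁻¹) volume (-B) B ∧
      IntervalIntegrable (fun t => (γ t - 0)⁻¹) volume (-B) B := fun γ hγ h =>
    ⟨(Continuous.inv₀ (by fun_prop) fun t => hwz _ (h t)).intervalIntegrable _ _,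
      (Continuous.inv₀ (by fun_prop) fun t => by simpa using hw0 _ (h t)).intervalIntegrable _ _⟩
  have H1 : ∀ c : ℝ, |c| = B → (∫ t : ℝ in (-B)..B, ((t : ℂ) + c * I - z)⁻¹) -
      (∫ t : ℝ in (-B)..B, ((t : ℂ) + c * I - 0)⁻¹) =
      log (((B : ℝ) + c * I - z) / ((B : ℝ) + c * I)) -
        log (((-B : ℝ) + c * I - z) / ((-B : ℝ) + c * I)) := fun c hc => by
    obtain ⟨j1, j2⟩ := ii (fun t : ℝ => (t : ℂ) + c * I) (by fun_prop) (hmem1 c hc)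
    rw [← integral_sub j1 j2]
    refine integral_eq_sub_of_hasDerivAt (f := fun t : ℝ => log (((t : ℂ) + c * I - z) / (t + c * I)))
      (fun t _ => ?_) (j1.sub j2)
    have := (hG _ (hmem1 c hc t)).comp t ((hasDerivAt_id t).ofReal_comp.add_const (c * I))
    simpa [Function.comp_def] using this
  have H2 : ∀ c : ℝ, |c| = B → I * (∫ t : ℝ in (-B)..B, ((c : ℂ) + t * I - z)⁻¹) -
      I * (∫ t : ℝ in (-B)..B, ((c : ℂ) + t * I - 0)⁻¹) =
      log ((c + (B : ℝ) * I - z) / (c + (B : ℝ) * I)) -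
        log ((c + (-B : ℝ) * I - z) / (c + (-B : ℝ) * I)) := fun c hc => by
    obtain ⟨j1, j2⟩ := ii (fun t : ℝ => (c : ℂ) + t * I) (by fun_prop) (hmem2 c hc)
    rw [← mul_sub, ← integral_sub j1 j2, ← intervalIntegral.integral_const_mul]
    refine integral_eq_sub_of_hasDerivAt (f := fun t : ℝ => log (((c : ℂ) + t * I - z) / (c + t * I)))
      (fun t _ => ?_) ((j1.sub j2).const_mul I)
    have := (hG _ (hmem2 c hc t)).comp t
      (((hasDerivAt_id t).ofReal_comp.mul_const I).const_add (c : ℂ))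
    simpa [Function.comp_def, mul_comm] using this
  have hb : |B| = B := abs_of_pos hB
  have hb' : |(-B)| = B := by rw [abs_neg, hb]
  have a1 := H1 (-B) hb'
  have a2 := H1 B hb
  have a3 := H2 B hb
  have a4 := H2 (-B) hb'
  unfold squareIntegral
  linear_combination a1 - a2 + a3 - a4

/-- A form of the **Cauchy–Pompeiu formula** on a square. -/
theorem squareIntegral_mul_eq {B : ℝ} {k : ℂ → ℂ} (hk : ContDiff ℝ 1 k)
    (hsupp : ∀ w : ℂ, B ≤ |w.re| ∨ B ≤ |w.im| → k w = 0) {z : ℂ} (hre : |z.re| < B)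
    (him : |z.im| < B) (hz : ∀ᶠ w in 𝓝 z, DifferentiableAt ℂ k w) :
    -(k z * squareIntegral B z) =
      ∫ x : ℝ in (-B)..B, ∫ y : ℝ in (-B)..B, (x + y * I - z)⁻¹ * dbar k (x + y * I) := by
  have hB : 0 < B := (abs_nonneg _).trans_lt hre
  -- The divided difference has no singularity at `z`, since `k` is holomorphic there; Green's
  -- formula thus applies on the whole square without excising a disk.
  set F := dslope k z with hF
  have hFne : ∀ w, w ≠ z → F =ᶠ[𝓝 w] fun x => (x - z)⁻¹ * (k x - k z) := fun w hw => by
    filter_upwards [isOpen_ne.mem_nhds hw] with x hx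
    rw [hF, dslope_of_ne _ hx, slope_def_field]
    field_simp
  obtain ⟨s, hsz, hs⟩ := eventually_iff_exists_mem.1 hz
  have hFz : ∀ᶠ w in 𝓝 z, DifferentiableAt ℂ F w := by
    have : DifferentiableOn ℂ F (interior s) :=
      (Complex.differentiableOn_dslope (interior_mem_nhds.2 hsz)).2
        fun w hw => (hs w (interior_subset hw)).differentiableWithinAt
    filter_upwards [interior_mem_nhds.2 hsz] with w hw
    exact this.differentiableAt (isOpen_interior.mem_nhds hw)
  have hkd : Differentiable ℝ k := hk.differentiable one_ne_zero
  have hinv : ∀ w, w ≠ z → DifferentiableAt ℂ (fun x => (x - z)⁻¹) w := fun w hw =>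
    (differentiableAt_id.sub_const z).inv (sub_ne_zero.2 hw)
  have hFd : Differentiable ℝ F := fun w => by
    by_cases hw : w = z
    · exact hw ▸ hFz.self_of_nhds.restrictScalars ℝ
    · exact (((hinv w hw).restrictScalars ℝ).mul ((hkd w).sub_const _)).congr_of_eventuallyEq
        (hFne w hw)
  have hdb : ∀ w, dbar F w = (w - z)⁻¹ * dbar k w := fun w => by
    by_cases hw : w = z
    · subst hw; simp [dbar_eq_zero hFz.self_of_nhds]
    · rw [dbar_congr (hFne w hw), dbar_mul (hinv w hw) ((hkd w).sub_const _), dbar_sub_const]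
  have hcont : Continuous (dbar F) := by
    rw [continuous_iff_continuousAt]
    intro w
    by_cases hw : w = z
    · subst hw
      have : dbar F =ᶠ[𝓝 w] fun _ => 0 := by filter_upwards [hFz] with x hx using dbar_eq_zero hx
      exact continuousAt_const.congr this.symm
    · have : dbar F = fun w => (w - z)⁻¹ * dbar k w := funext hdb
      rw [this]
      exact (hinv w hw).continuousAt.mul (continuous_dbar hk).continuousAt
  -- On the boundary `k` vanishes, so only the Cauchy kernel term remains.
  have hedge : ∀ w : ℂ, |w.re| = B ∨ |w.im| = B → F w = -k z * (w - z)⁻¹ := fun w hw => by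
    have hwz : w ≠ z := by rintro rfl; rcases hw with h | h <;> linarith
    have := (hFne w hwz).self_of_nhds
    simp only at this
    rw [this, hsupp w (hw.imp ge_of_eq ge_of_eq)]
    ring
  have hb : |B| = B := abs_of_pos hB
  have hb' : |(-B)| = B := by rw [abs_neg, hb]
  have main := integral_boundary_rect_of_differentiableOn_real F (-B + -B * I) (B + B * I)
    hFd.differentiableOn ((hcont.continuousOn).integrableOn_compact
      (isCompact_uIcc.reProdIm isCompact_uIcc))
  have r1 : (-(B : ℂ) + -B * I).re = -B := by simp
  have r2 : (-(B : ℂ) + -B * I).im = -B := by simp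
  have r3 : ((B : ℂ) + B * I).re = B := by simp
  have r4 : ((B : ℂ) + B * I).im = B := by simp
  rw [r1, r2, r3, r4] at main
  have s1 : ∀ c : ℝ, |c| = B → (∫ x : ℝ in (-B)..B, F (x + c * I)) =
      -k z * ∫ x : ℝ in (-B)..B, (x + c * I - z)⁻¹ := fun c hc => by
    rw [← intervalIntegral.integral_const_mul]
    exact integral_congr fun t _ => hedge _ (Or.inr (by simpa))
  have s2 : ∀ c : ℝ, |c| = B → (∫ y : ℝ in (-B)..B, F (c + y * I)) =
      -k z * ∫ y : ℝ in (-B)..B, (c + y * I - z)⁻¹ := fun c hc => by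
    rw [← intervalIntegral.integral_const_mul]
    exact integral_congr fun t _ => hedge _ (Or.inl (by simpa))
  rw [s1 _ hb', s1 _ hb, s2 _ hb, s2 _ hb'] at main
  have hrhs : ∀ x y : ℝ, I • fderiv ℝ F (x + y * I) 1 - fderiv ℝ F (x + y * I) I =
      (x + y * I - z)⁻¹ * dbar k (x + y * I) := fun x y => hdb (x + y * I)
  simp only [hrhs] at main
  rw [← main, squareIntegral]
  simp only [smul_eq_mul]
  ring

end Runge

/-! ### Runge's theorem through resolvents in a closed subalgebra -/

section PolynomialApproximation

open Complex MeasureTheory intervalIntegral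

theorem dbar_eventually_eq_zero {k : ℂ → ℂ} {z : ℂ} (hz : ∀ᶠ w in 𝓝 z, DifferentiableAt ℂ k w) :
    dbar k =ᶠ[𝓝 z] 0 := by
  filter_upwards [hz] with w hw using dbar_eq_zero hw

/-- A compactly supported `C¹` function that is holomorphic near a compact set without holes is
a uniform limit of polynomials on this set. -/
theorem exists_polynomial_near_of_hasCompactSupport {L : Set ℂ} (hL : IsCompact L)
    (hfill : fill L ⊆ L) {k : ℂ → ℂ} (hk : ContDiff ℝ 1 k) (hsupp : HasCompactSupport k)
    (hhol : ∀ z ∈ L, ∀ᶠ w in 𝓝 z, DifferentiableAt ℂ k w) {ε : ℝ} (hε : 0 < ε) :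
    ∃ p : Polynomial ℂ, ∀ z ∈ L, ‖p.eval z - k z‖ < ε := by
  classical
  have : CompactSpace L := isCompact_iff_compactSpace.1 hL
  obtain ⟨R, hR⟩ := (hL.isBounded.union hsupp.isBounded).exists_norm_le
  set B : ℝ := max R 0 + 1 with hBdef
  have hB : 0 < B := by positivity
  have hRB : R < B := (le_max_left R 0).trans_lt (lt_add_one _)
  have hLB : ∀ z ∈ L, |z.re| < B ∧ |z.im| < B := fun z hz =>
    ⟨(abs_re_le_norm z).trans_lt ((hR z (Or.inl hz)).trans_lt hRB),
      (abs_im_le_norm z).trans_lt ((hR z (Or.inl hz)).trans_lt hRB)⟩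
  have hkB : ∀ w : ℂ, B ≤ |w.re| ∨ B ≤ |w.im| → k w = 0 := fun w hw => by
    by_contra hne
    have := hR w (Or.inr (subset_tsupport k hne))
    rcases hw with hw | hw
    · linarith [abs_re_le_norm w]
    · linarith [abs_im_le_norm w]
  -- the closed algebra generated by polynomials
  let P : Subalgebra ℂ C(L, ℂ) := (polynomialFunctions L).topologicalClosure
  have hPc : IsClosed (P : Set C(L, ℂ)) := Subalgebra.isClosed_topologicalClosure _
  have : CompleteSpace P := hPc.completeSpace_coe
  let ξ' : C(L, ℂ) := (Polynomial.X : Polynomial ℂ).toContinuousMapOn L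
  have hξ' : ∀ z : L, ξ' z = z := fun z => by simp [ξ']
  let ξ : P := ⟨ξ', Subalgebra.le_topologicalClosure _
    ⟨Polynomial.X, by simp, rfl⟩⟩
  have hspec : spectrum ℂ (ξ : C(L, ℂ)) = L := by
    rw [ContinuousMap.spectrum_eq_range]
    ext z
    constructor
    · rintro ⟨y, rfl⟩
      rw [show (ξ : C(L, ℂ)) y = y from hξ' y]
      exact y.2
    · exact fun hz => ⟨⟨z, hz⟩, hξ' _⟩
  -- Passing to a closed subalgebra can enlarge a spectrum only by filling in holes, and `L` has
  -- none. Hence each Cauchy kernel with pole off `L` is a uniform limit of polynomials on `L`.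
  have hres : ∀ w, w ∉ L → w ∈ resolventSet ℂ ξ := fun w hw => by
    by_contra hw'
    have := Subalgebra.spectrum_isBounded_connectedComponentIn P ξ (z := w) hw'
    rw [hspec] at this
    exact hw (hfill this)
  let ev : L → P →L[ℂ] ℂ := fun z =>
    (ContinuousMap.evalCLM ℂ z).comp P.toSubmodule.subtypeL
  have hev : ∀ (z : L) (a : P), ev z a = (a : C(L, ℂ)) z := fun _ _ => rfl
  have hresolvent : ∀ w, w ∉ L → ∀ z : L, ev z (resolvent ξ w) = (w - z)⁻¹ := fun w hw z => by
    have h1 : (algebraMap ℂ P w - ξ) * resolvent ξ w = 1 :=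
      Ring.mul_inverse_cancel _ (hres w hw)
    have h2 : (w - z) * ev z (resolvent ξ w) = 1 := by
      have := congrArg (ev z) h1
      simpa [hev, ← hξ' z, Subalgebra.coe_mul] using this
    exact eq_inv_of_mul_eq_one_right h2
  -- The default value of the resolvent on the spectrum is harmless: `dbar k` vanishes near `L`,
  -- which also gives continuity there.
  let Φ : ℂ → P := fun w => dbar k w • resolvent ξ w
  have hΦc : Continuous Φ := by
    rw [continuous_iff_continuousAt]
    intro w
    by_cases hw : w ∈ L
    · have : Φ =ᶠ[𝓝 w] fun _ => 0 := by
        filter_upwards [dbar_eventually_eq_zero (hhol w hw)] with x hx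
        simp [Φ, hx]
      exact continuousAt_const.congr this.symm
    · exact (continuous_dbar hk).continuousAt.smul
        (spectrum.hasDerivAt_resolvent_const_left (hres w hw)).continuousAt
  have hΦ : ∀ (w : ℂ) (z : L), ev z (Φ w) = (w - z)⁻¹ * dbar k w := fun w z => by
    by_cases hw : w ∈ L
    · simp [Φ, (dbar_eventually_eq_zero (hhol w hw)).self_of_nhds]
    · simp only [Φ, map_smul, hresolvent w hw z, smul_eq_mul, mul_comm]
  have hcoord : Continuous fun q : ℝ × ℝ => (q.1 : ℂ) + q.2 * I := by fun_prop
  have hΦ2 : Continuous (Function.uncurry fun x y : ℝ => Φ (x + y * I)) := hΦc.comp hcoord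
  -- The Cauchy–Pompeiu integral, taken with values in the Banach space `P`, automatically stays in
  -- the closure of the polynomials; evaluation at points of `L` identifies it with `k`.
  let T : P := (-(squareIntegral B 0)⁻¹) • ∫ x : ℝ in (-B)..B, ∫ y : ℝ in (-B)..B, Φ (x + y * I)
  have hT : ∀ z : L, ev z T = k z := fun z => by
    have e1 : ev z (∫ x : ℝ in (-B)..B, ∫ y : ℝ in (-B)..B, Φ (x + y * I)) =
        ∫ x : ℝ in (-B)..B, ∫ y : ℝ in (-B)..B, (x + y * I - z)⁻¹ * dbar k (x + y * I) := by
      rw [← ContinuousLinearMap.intervalIntegral_comp_comm]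
      · refine integral_congr fun x _ => ?_
        rw [← ContinuousLinearMap.intervalIntegral_comp_comm]
        · exact integral_congr fun y _ => hΦ _ z
        · exact Continuous.intervalIntegrable (hΦc.comp (by fun_prop)) _ _
      · exact Continuous.intervalIntegrable
          (continuous_parametric_intervalIntegral_of_continuous' hΦ2 _ _) _ _
    have e2 := squareIntegral_mul_eq hk hkB (hLB z z.2).1 (hLB z z.2).2 (hhol z z.2)
    rw [squareIntegral_eq (hLB z z.2).1 (hLB z z.2).2, ← e1] at e2
    have h0 := squareIntegral_zero_ne_zero hB
    simp only [T, map_smul, ← e2, smul_eq_mul]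
    field_simp
  have hmem : (T : C(L, ℂ)) ∈ closure (polynomialFunctions L : Set C(L, ℂ)) := T.2
  obtain ⟨q, hq, hqε⟩ := Metric.mem_closure_iff.1 hmem ε hε
  rw [polynomialFunctions_coe] at hq
  obtain ⟨p, rfl⟩ := hq
  refine ⟨p, fun z hz => ?_⟩
  have h1 := (ContinuousMap.dist_lt_iff hε).1 hqε ⟨z, hz⟩
  rw [dist_comm, dist_eq_norm] at h1
  have h2 : (T : C(L, ℂ)) ⟨z, hz⟩ = k z := hT ⟨z, hz⟩
  rw [h2] at h1
  simpa using h1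

/-- **Runge's theorem**: a function that is holomorphic near a compact set without holes is
a uniform limit of polynomials on this set. -/
theorem exists_polynomial_near {L U : Set ℂ} (hL : IsCompact L) (hfill : fill L ⊆ L)
    (hU : IsOpen U) (hLU : L ⊆ U) {h : ℂ → ℂ} (hh : DifferentiableOn ℂ h U) {ε : ℝ} (hε : 0 < ε) :
    ∃ p : Polynomial ℂ, ∀ z ∈ L, ‖p.eval z - h z‖ < ε := by
  -- The cutoff equals 1 on `K₁`, whose interior contains `L`, and is supported in `K₂` inside `U`;
  -- so the product with `h` is globally C¹ and agrees with `h` near `L`.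
  obtain ⟨K₁, hK₁, hLK₁, hK₁U⟩ := exists_compact_between hL hU hLU
  obtain ⟨K₂, hK₂, hK₁₂, hK₂U⟩ := exists_compact_between hK₁ hU hK₁U
  obtain ⟨χ, hχ, -, hχs, hχ1⟩ := exists_contMDiff_support_eq_eq_one_iff (n := 1)
    (modelWithCornersSelf ℝ ℂ) (isOpen_interior (s := K₂)) hK₁.isClosed hK₁₂
  have hts : tsupport χ ⊆ K₂ := by
    rw [tsupport, hχs]; exact closure_minimal interior_subset hK₂.isClosed
  set k : ℂ → ℂ := fun w => (χ w : ℂ) * h w with hkdef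
  have hkχ : ∀ w ∉ tsupport χ, k =ᶠ[𝓝 w] 0 := fun w hw => by
    filter_upwards [(isClosed_tsupport χ).isOpen_compl.mem_nhds hw] with x hx
    simp [hkdef, image_eq_zero_of_notMem_tsupport hx]
  have hk1 : ∀ z ∈ L, k =ᶠ[𝓝 z] h := fun z hz => by
    filter_upwards [isOpen_interior.mem_nhds (hLK₁ hz)] with x hx
    simp [hkdef, (hχ1 x).1 (interior_subset hx)]
  have hkd : ContDiff ℝ 1 k := by
    rw [contDiff_iff_contDiffAt]
    intro w
    by_cases hw : w ∈ tsupport χ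
    · have hwU := hU.mem_nhds (hK₂U (hts hw))
      have h1 : ContDiffAt ℂ 1 h w := (hh.contDiffOn hU).contDiffAt hwU
      have h2 : ContDiffAt ℝ 1 (fun w => (χ w : ℂ)) w :=
        ofRealCLM.contDiff.contDiffAt.comp w hχ.contDiff.contDiffAt
      exact h2.mul (h1.restrict_scalars ℝ)
    · exact contDiffAt_const.congr_of_eventuallyEq (hkχ w hw)
  have hks : HasCompactSupport k := by
    refine HasCompactSupport.intro hK₂ fun w hw => ?_
    have := (hkχ w fun h => hw (hts h)).self_of_nhds
    simpa using this
  have hkh : ∀ z ∈ L, ∀ᶠ w in 𝓝 z, DifferentiableAt ℂ k w := fun z hz => by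
    filter_upwards [(hk1 z hz).eventuallyEq_nhds, hU.mem_nhds (hLU hz)] with w hw hwU
    exact (hh.differentiableAt (hU.mem_nhds hwU)).congr_of_eventuallyEq hw
  obtain ⟨p, hp⟩ := exists_polynomial_near_of_hasCompactSupport hL hfill hkd hks hkh hε
  refine ⟨p, fun z hz => ?_⟩
  rw [← (hk1 z hz).self_of_nhds]
  exact hp z hz

end PolynomialApproximation

/-! ### Primitives and square roots on domains without holes -/

/-- Every compact subset of `U` is contained in a compact subset of `U` without holes. -/
def IsExhaustedByFull (U : Set ℂ) : Prop :=
  ∀ C ⊆ U, IsCompact C → ∃ L, IsCompact L ∧ C ⊆ L ∧ L ⊆ U ∧ fill L ⊆ L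

theorem exists_seq_isCompact_superset {U : Set ℂ} (hU : IsOpen U) :
    ∃ C : ℕ → Set ℂ, (∀ n, IsCompact (C n) ∧ C n ⊆ U) ∧
      ∀ K ⊆ U, IsCompact K → ∀ᶠ n in atTop, K ⊆ C n := by
  have := hU.isOpenEmbedding_subtypeVal.locallyCompactSpace
  let E : CompactExhaustion U := default
  refine ⟨fun n => Subtype.val '' E n, fun n => ⟨(E.isCompact n).image continuous_subtype_val,
    Subtype.coe_image_subset _ _⟩, fun K hKU hK => ?_⟩
  have hK' : IsCompact ((↑) ⁻¹' K : Set U) :=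
    IsInducing.subtypeVal.isCompact_preimage' hK (by simpa using hKU)
  obtain ⟨n, hn⟩ := E.exists_superset_of_isCompact hK'
  filter_upwards [eventually_ge_atTop n] with m hm x hx
  exact ⟨⟨x, hKU hx⟩, E.subset hm (hn hx), rfl⟩

/-- Polynomials converging to `h` locally uniformly have primitives vanishing at `z₀`. Convergence
of these at one point spreads to balls inside `U`, hence to all of `U` by connectedness, and the
limit is a primitive of `h`. -/
theorem isExactOn_of_isExhaustedByFull {U : Set ℂ} (hU : IsOpen U) (hc : IsPreconnected U)
    (hex : IsExhaustedByFull U) {h : ℂ → ℂ} (hh : DifferentiableOn ℂ h U) :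
    Complex.IsExactOn h U := by
  rcases U.eq_empty_or_nonempty with rfl | ⟨z₀, hz₀⟩
  · exact ⟨0, by simp⟩
  obtain ⟨C, hC, hCK⟩ := exists_seq_isCompact_superset hU
  have hp : ∀ n : ℕ, ∃ p : Polynomial ℂ, ∀ z ∈ C n, ‖p.eval z - h z‖ < 1 / ((n : ℝ) + 1) :=
    fun n => by
    obtain ⟨L, hL, hCL, hLU, hfill⟩ := hex (C n) (hC n).2 (hC n).1
    obtain ⟨p, hp⟩ := exists_polynomial_near hL hfill hU hLU hh
      (show (0 : ℝ) < 1 / ((n : ℝ) + 1) by positivity)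
    exact ⟨p, fun z hz => hp z (hCL hz)⟩
  choose p hp using hp
  have hq : ∀ n : ℕ, ∃ q : ℂ → ℂ, q z₀ = 0 ∧ ∀ z, HasDerivAt q ((p n).eval z) z := fun n => by
    obtain ⟨q, hq0, hq⟩ := ((p n).differentiable.isExactOn_univ).with_val_at z₀ 0
    exact ⟨q, hq0, fun z => hq z (mem_univ z)⟩
  choose q hq0 hq using hq
  have hunif : ∀ K ⊆ U, IsCompact K →
      TendstoUniformlyOn (fun n z => (p n).eval z) h atTop K := fun K hKU hK => by
    rw [Metric.tendstoUniformlyOn_iff]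
    intro ε hε
    filter_upwards [hCK K hKU hK,
      tendsto_one_div_add_atTop_nhds_zero_nat.eventually (gt_mem_nhds hε)] with n hn hnε z hz
    rw [dist_comm, dist_eq_norm]
    exact (hp n z (hn hz)).trans hnε
  let t : Set ℂ := {x | Cauchy (map (fun n => q n x) atTop)}
  have hball : ∀ x r, closedBall x r ⊆ U → x ∈ t → ball x r ⊆ t := fun x r hr hx y hy =>
    (uniformCauchySeqOn_ball_of_deriv (f := q) (f' := fun n z => (p n).eval z)
      ((hunif _ hr (isCompact_closedBall x r)).uniformCauchySeqOn.mono ball_subset_closedBall)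
      (fun n y _ => hq n y) hx).cauchy_map hy
  have hUt : U ⊆ interior t := by
    have hint : ∀ x ∈ U, x ∈ t → x ∈ interior t := fun x hxU hx => by
      obtain ⟨r, hr, hrU⟩ := Metric.nhds_basis_closedBall.mem_iff.1 (hU.mem_nhds hxU)
      exact mem_interior_iff_mem_nhds.2 (mem_of_superset (ball_mem_nhds x hr) (hball x r hrU hx))
    refine hc.subset_of_closure_inter_subset isOpen_interior
      ⟨z₀, hz₀, hint z₀ hz₀ ?_⟩ fun y ⟨hy, hyU⟩ => hint y hyU ?_
    · simp only [t, mem_ofPred_eq, hq0]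
      exact (tendsto_const_nhds (x := (0 : ℂ))).cauchy_map
    · obtain ⟨r, hr, hrU⟩ := Metric.nhds_basis_closedBall.mem_iff.1 (hU.mem_nhds hyU)
      obtain ⟨x, hx, hxy⟩ := Metric.mem_closure_iff.1 hy (r / 2) (half_pos hr)
      -- The ball of radius `r / 2` about `x` contains `y` and its closure stays within distance `r`
      -- of `y`.
      refine hball x (r / 2) (Subset.trans (closedBall_subset_closedBall' ?_) hrU)
        (interior_subset hx) hxy
      rw [dist_comm] at hxy
      linarith
  have hlim : ∀ x, ∃ y, x ∈ U → Tendsto (fun n => q n x) atTop (𝓝 y) := fun x => by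
    by_cases hx : x ∈ U
    · have hx' : x ∈ t := interior_subset (hUt hx)
      obtain ⟨y, hy⟩ := cauchySeq_tendsto_of_complete hx'
      exact ⟨y, fun _ => hy⟩
    · exact ⟨0, fun h => absurd h hx⟩
  choose H hH using hlim
  exact ⟨H, fun z hz => hasDerivAt_of_tendstoLocallyUniformlyOn hU
    ((tendstoLocallyUniformlyOn_iff_forall_isCompact hU).2 hunif)
    (Eventually.of_forall fun n x _ => hq n x) hH hz⟩

/-- With `H` a primitive of g'/g, the function g·exp(-H) is constant, and a square root of that
constant times exp(H/2) is the root sought. -/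
theorem exists_sq_eq_of_ne_zero {U : Set ℂ} (hU : IsOpen U) (hc : IsPreconnected U)
    (hex : IsExhaustedByFull U) {g : ℂ → ℂ} (hg : DifferentiableOn ℂ g U)
    (hg0 : ∀ z ∈ U, g z ≠ 0) :
    ∃ S : ℂ → ℂ, DifferentiableOn ℂ S U ∧ ∀ z ∈ U, S z ^ 2 = g z := by
  obtain ⟨H, hH⟩ := isExactOn_of_isExhaustedByFull hU hc hex ((hg.deriv hU).div hg hg0)
  have hd : ∀ z ∈ U, HasDerivAt (fun z => g z * Complex.exp (-H z)) 0 z := fun z hz => by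
    have h1 := (hg.differentiableAt (hU.mem_nhds hz)).hasDerivAt.mul (hH z hz).neg.cexp
    refine h1.congr_deriv ?_
    have := hg0 z hz
    simp only [Pi.div_apply, Pi.neg_apply]
    field_simp
    ring
  obtain ⟨c, hcst⟩ := hU.exists_is_const_of_deriv_eq_zero hc
    (fun z hz => (hd z hz).differentiableAt.differentiableWithinAt) (fun z hz => (hd z hz).deriv)
  obtain ⟨b, hb⟩ := IsAlgClosed.exists_pow_nat_eq c two_pos
  refine ⟨fun z => b * Complex.exp (H z / 2), fun z hz => ?_, fun z hz => ?_⟩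
  · exact ((((hH z hz).differentiableAt.div_const 2).cexp).const_mul b).differentiableWithinAt
  · rw [mul_pow, hb, ← hcst z hz, mul_assoc, ← Complex.exp_nat_mul, ← Complex.exp_add]
    have : -H z + (2 : ℕ) * (H z / 2) = 0 := by push_cast; ring
    rw [this, Complex.exp_zero, mul_one]

/-! ### Approximate Riemann maps -/

open ComplexConjugate in
/-- The disk automorphism moving `a` to `0`. -/
noncomputable def diskShift (a w : ℂ) : ℂ := (w - a) / (1 - conj a * w)

section DiskShift

open ComplexConjugate Complex

variable {a w : ℂ}

theorem norm_sq_sub_norm_sq_diskShift (a w : ℂ) :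
    ‖1 - conj a * w‖ ^ 2 - ‖w - a‖ ^ 2 = (1 - ‖a‖ ^ 2) * (1 - ‖w‖ ^ 2) := by
  simp only [← normSq_eq_norm_sq, normSq_apply, sub_re, sub_im, mul_re, mul_im, conj_re, conj_im,
    one_re, one_im]
  ring

theorem diskShift_denom_ne_zero (ha : ‖a‖ < 1) (hw : ‖w‖ < 1) : 1 - conj a * w ≠ 0 := fun h => by
  have h1 : ‖conj a * w‖ = 1 := by rw [← sub_eq_zero.1 h, norm_one]
  rw [norm_mul, RCLike.norm_conj] at h1
  nlinarith [norm_nonneg a, norm_nonneg w]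

theorem norm_diskShift_lt_one (ha : ‖a‖ < 1) (hw : ‖w‖ < 1) : ‖diskShift a w‖ < 1 := by
  have h := norm_pos_iff.2 (diskShift_denom_ne_zero ha hw)
  rw [diskShift, norm_div, div_lt_one h]
  refine lt_of_pow_lt_pow_left₀ 2 h.le ?_
  have := norm_sq_sub_norm_sq_diskShift a w
  nlinarith [mul_pos (show 0 < 1 - ‖a‖ ^ 2 by nlinarith [norm_nonneg a])
    (show 0 < 1 - ‖w‖ ^ 2 by nlinarith [norm_nonneg w])]

theorem diskShift_injOn (ha : ‖a‖ < 1) : InjOn (diskShift a) (ball 0 1) := by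
  intro v hv w hw h
  rw [mem_ball_zero_iff] at hv hw
  rw [diskShift, diskShift,
    div_eq_div_iff (diskShift_denom_ne_zero ha hv) (diskShift_denom_ne_zero ha hw)] at h
  have h1 : (1 - conj a * a) * (v - w) = 0 := by linear_combination h
  rcases mul_eq_zero.1 h1 with h2 | h2
  · exact absurd h2 (diskShift_denom_ne_zero ha ha)
  · exact sub_eq_zero.1 h2

theorem hasDerivAt_diskShift (ha : ‖a‖ < 1) (hw : ‖w‖ < 1) :
    HasDerivAt (diskShift a) ((1 - conj a * a) / (1 - conj a * w) ^ 2) w := by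
  have := ((hasDerivAt_id w).sub_const a).div
    (((hasDerivAt_id w).const_mul (conj a)).const_sub 1) (diskShift_denom_ne_zero ha hw)
  refine this.congr_deriv ?_
  simp only [id]
  ring

/-- A Harnack-type estimate: the points at pseudohyperbolic distance at most 1/2 from the disk of
radius `c` stay uniformly away from the unit circle. -/
theorem one_sub_norm_sq_le_of_norm_diskShift_le_half {c : ℝ} (ha : ‖a‖ ≤ c) (hc : c < 1)
    (hw : ‖w‖ < 1) (h : ‖diskShift a w‖ ≤ 1 / 2) : 3 / 4 * (1 - c) ^ 2 ≤ 1 - ‖w‖ ^ 2 := by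
  have hpos := norm_pos_iff.2 (diskShift_denom_ne_zero (ha.trans_lt hc) hw)
  rw [diskShift, norm_div, div_le_iff₀ hpos] at h
  have h1 := norm_sq_sub_norm_sq_diskShift a w
  have h2 : 1 - c ≤ ‖1 - conj a * w‖ := by
    have := norm_sub_norm_le (1 : ℂ) (conj a * w)
    rw [norm_one, norm_mul, RCLike.norm_conj] at this
    nlinarith [norm_nonneg a, norm_nonneg w]
  have h3 : ‖w - a‖ ^ 2 ≤ (1 / 2 * ‖1 - conj a * w‖) ^ 2 :=
    pow_le_pow_left₀ (norm_nonneg _) h 2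
  have h4 : (1 - c) ^ 2 ≤ ‖1 - conj a * w‖ ^ 2 := pow_le_pow_left₀ (by linarith) h2 2
  nlinarith [mul_nonneg (sq_nonneg ‖a‖) (show 0 ≤ 1 - ‖w‖ ^ 2 by nlinarith [norm_nonneg w])]

end DiskShift

/-- Holomorphic maps of `U` to the unit disk that send `z₀` to `0`. -/
structure IsDiskMap (U : Set ℂ) (z₀ : ℂ) (φ : ℂ → ℂ) : Prop where
  differentiableOn : DifferentiableOn ℂ φ U
  norm_lt_one : ∀ z ∈ U, ‖φ z‖ < 1
  map_base : φ z₀ = 0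

/-! ### Koebe's extremal problem -/

section Koebe

variable {U : Set ℂ} {z₀ : ℂ}

theorem IsDiskMap.comp_diskShift {φ : ℂ → ℂ} (hφ : DifferentiableOn ℂ φ U)
    (hφ1 : ∀ z ∈ U, ‖φ z‖ < 1) (hz₀ : z₀ ∈ U) :
    IsDiskMap U z₀ (fun z => diskShift (φ z₀) (φ z)) where
  differentiableOn z hz :=
    ((hasDerivAt_diskShift (hφ1 z₀ hz₀) (hφ1 z hz)).differentiableAt).comp_differentiableWithinAt z
      (hφ z hz)
  norm_lt_one z hz := norm_diskShift_lt_one (hφ1 z₀ hz₀) (hφ1 z hz)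
  map_base := by simp [diskShift]

/-- On a compact set, all disk maps stay uniformly away from the unit circle. -/
theorem exists_norm_le_of_isDiskMap (hU : IsOpen U) (hc : IsPreconnected U) (hz₀ : z₀ ∈ U)
    {K : Set ℂ} (hK : IsCompact K) (hKU : K ⊆ U) :
    ∃ c < 1, ∀ φ, IsDiskMap U z₀ φ → ∀ z ∈ K, ‖φ z‖ ≤ c := by
  let t : Set ℂ := {z | ∃ c < 1, ∀ φ, IsDiskMap U z₀ φ → ‖φ z‖ ≤ c}
  have hball : ∀ x r, 0 < r → ball x (2 * r) ⊆ U → x ∈ t →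
      ∃ c < 1, ∀ w ∈ ball x r, ∀ φ, IsDiskMap U z₀ φ → ‖φ w‖ ≤ c := by
    rintro x r hr hrU ⟨c, hc1, hc⟩
    have hxU : x ∈ U := hrU (mem_ball_self (by linarith))
    refine ⟨√(1 - 3 / 4 * (1 - c) ^ 2), ?_, fun w hw φ hφ => ?_⟩
    · rw [Real.sqrt_lt' one_pos]
      nlinarith [pow_pos (sub_pos.2 hc1) 2]
    have hwU : w ∈ U := hrU (ball_subset_ball (by linarith) hw)
    have hψ := IsDiskMap.comp_diskShift hφ.differentiableOn hφ.norm_lt_one hxU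
    -- Schwarz's lemma after moving `φ x` to 0: halving the radius bounds the pseudohyperbolic
    -- distance from `φ x` to `φ w` by 1/2, independently of `φ`.
    have h1 := Complex.dist_le_div_mul_dist_of_mapsTo_ball (R₂ := 1)
      (hψ.differentiableOn.mono hrU)
      (fun z hz => by
        rw [hψ.map_base, mem_closedBall_zero_iff]
        exact (hψ.norm_lt_one z (hrU hz)).le) (ball_subset_ball (by linarith) hw)
    rw [hψ.map_base, dist_zero_right] at h1
    have h2 : 1 / (2 * r) * dist w x ≤ 1 / 2 := by
      rw [div_mul_eq_mul_div, div_le_div_iff₀ (by positivity) two_pos]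
      have := mem_ball.1 hw
      linarith
    have h3 := one_sub_norm_sq_le_of_norm_diskShift_le_half (hc φ hφ) hc1 (hφ.norm_lt_one w hwU)
      (h1.trans h2)
    exact Real.le_sqrt_of_sq_le (by linarith)
  have hUt : U ⊆ interior t := by
    have hint : ∀ x ∈ U, x ∈ t → x ∈ interior t := fun x hxU hx => by
      obtain ⟨r, hr, hrU⟩ := Metric.isOpen_iff.1 hU x hxU
      obtain ⟨c, hc1, hc⟩ := hball x (r / 2) (half_pos hr) (by rwa [mul_div_cancel₀ _ two_ne_zero]) hx
      exact mem_interior_iff_mem_nhds.2 (mem_of_superset (ball_mem_nhds x (half_pos hr))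
        fun w hw => ⟨c, hc1, hc w hw⟩)
    refine hc.subset_of_closure_inter_subset isOpen_interior
      ⟨z₀, hz₀, hint z₀ hz₀ ⟨0, one_pos, fun φ hφ => by simp [hφ.map_base]⟩⟩
      fun y ⟨hy, hyU⟩ => hint y hyU ?_
    obtain ⟨r, hr, hrU⟩ := Metric.isOpen_iff.1 hU y hyU
    obtain ⟨x, hx, hxy⟩ := Metric.mem_closure_iff.1 hy (r / 4) (by linarith)
    obtain ⟨c, hc1, hc⟩ := hball x (r / 4) (by linarith)
      ((ball_subset_ball' (by rw [dist_comm] at hxy; linarith)).trans hrU) (interior_subset hx)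
    exact ⟨c, hc1, hc y hxy⟩
  refine hK.induction_on (p := fun s => ∃ c < 1, ∀ φ, IsDiskMap U z₀ φ → ∀ z ∈ s, ‖φ z‖ ≤ c)
    ⟨0, one_pos, by simp⟩ ?_ ?_ ?_
  · rintro s s' hs ⟨c, hc1, hc⟩
    exact ⟨c, hc1, fun φ hφ z hz => hc φ hφ z (hs hz)⟩
  · rintro s s' ⟨c, hc1, hc⟩ ⟨c', hc1', hc'⟩
    exact ⟨max c c', max_lt hc1 hc1', fun φ hφ z hz => hz.elim
      (fun h => (hc φ hφ z h).trans (le_max_left _ _))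
      fun h => (hc' φ hφ z h).trans (le_max_right _ _)⟩
  · intro x hx
    obtain ⟨r, hr, hrU⟩ := Metric.isOpen_iff.1 hU x (hKU hx)
    obtain ⟨c, hc1, hc⟩ := hball x (r / 2) (half_pos hr) (by rwa [mul_div_cancel₀ _ two_ne_zero])
      (interior_subset (hUt (hKU hx)))
    exact ⟨ball x (r / 2), mem_nhdsWithin_of_mem_nhds (ball_mem_nhds x (half_pos hr)), c, hc1,
      fun φ hφ z hz => hc z hz φ hφ⟩

/-- Koebe's square root trick: if an injective disk map omits a value, then there is another one
with a larger derivative. -/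
theorem exists_injOn_isDiskMap_deriv (hU : IsOpen U) (hc : IsPreconnected U)
    (hex : IsExhaustedByFull U) (hz₀ : z₀ ∈ U) {φ : ℂ → ℂ} (hφ : IsDiskMap U z₀ φ)
    (hinj : InjOn φ U) {a : ℂ} (ha : ‖a‖ < 1) (haU : ∀ z ∈ U, φ z ≠ a) :
    ∃ ψ, IsDiskMap U z₀ ψ ∧ InjOn ψ U ∧
      2 * √‖a‖ * ‖deriv ψ z₀‖ = (1 + ‖a‖) * ‖deriv φ z₀‖ := by
  have ha0 : a ≠ 0 := fun h => haU z₀ hz₀ (hφ.map_base.trans h.symm)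
  have hdT : ∀ z ∈ U, HasDerivAt (diskShift a) _ (φ z) := fun z hz =>
    hasDerivAt_diskShift ha (hφ.norm_lt_one z hz)
  have hφd : ∀ z ∈ U, HasDerivAt φ (deriv φ z) z := fun z hz =>
    (hφ.differentiableOn.differentiableAt (hU.mem_nhds hz)).hasDerivAt
  obtain ⟨S, hSd, hS⟩ := exists_sq_eq_of_ne_zero hU hc hex (g := fun z => diskShift a (φ z))
    (fun z hz => ((hdT z hz).comp z (hφd z hz)).differentiableAt.differentiableWithinAt)
    (fun z hz => div_ne_zero (sub_ne_zero.2 (haU z hz))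
      (diskShift_denom_ne_zero ha (hφ.norm_lt_one z hz)))
  have hS1 : ∀ z ∈ U, ‖S z‖ < 1 := fun z hz => by
    have := norm_diskShift_lt_one ha (hφ.norm_lt_one z hz)
    rw [← hS z hz, norm_pow] at this
    exact (pow_lt_one_iff_of_nonneg (norm_nonneg _) two_ne_zero).1 this
  have hS0 : S z₀ ^ 2 = -a := by rw [hS z₀ hz₀, hφ.map_base]; simp [diskShift]
  have hSn : ‖S z₀‖ ^ 2 = ‖a‖ := by rw [← norm_pow, hS0, norm_neg]
  have hsqrt : √‖a‖ = ‖S z₀‖ := by rw [← hSn, Real.sqrt_sq (norm_nonneg _)]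
  -- Move the omitted value to 0, take a square root, and move the image of `z₀` back to 0.
  refine ⟨fun z => diskShift (S z₀) (S z), IsDiskMap.comp_diskShift hSd hS1 hz₀, ?_, ?_⟩
  · intro v hv w hw h
    have h1 := diskShift_injOn (hS1 z₀ hz₀) (mem_ball_zero_iff.2 (hS1 v hv))
      (mem_ball_zero_iff.2 (hS1 w hw)) h
    have h2 : diskShift a (φ v) = diskShift a (φ w) := by rw [← hS v hv, ← hS w hw, h1]
    exact hinj hv hw (diskShift_injOn ha (mem_ball_zero_iff.2 (hφ.norm_lt_one v hv))
      (mem_ball_zero_iff.2 (hφ.norm_lt_one w hw)) h2)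
  have hSd0 : HasDerivAt S (deriv S z₀) z₀ :=
    (hSd.differentiableAt (hU.mem_nhds hz₀)).hasDerivAt
  have e1 := ((hasDerivAt_diskShift (hS1 z₀ hz₀) (hS1 z₀ hz₀)).comp z₀ hSd0).deriv
  have e2 : 2 * S z₀ * deriv S z₀ = (1 - (starRingEnd ℂ) a * a) * deriv φ z₀ := by
    have l1 := hSd0.pow 2
    have l2 := ((hdT z₀ hz₀).comp z₀ (hφd z₀ hz₀))
    have : (S ^ 2) =ᶠ[𝓝 z₀] (diskShift a ∘ φ) := by
      filter_upwards [hU.mem_nhds hz₀] with z hz using hS z hz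
    have := (l1.congr_of_eventuallyEq this.symm).unique l2
    rw [hφ.map_base] at this
    simpa using this
  have hne := diskShift_denom_ne_zero (hS1 z₀ hz₀) (hS1 z₀ hz₀)
  have hcc : ∀ b : ℂ, ‖b‖ < 1 → ‖1 - (starRingEnd ℂ) b * b‖ = 1 - ‖b‖ ^ 2 := fun b hb => by
    rw [Complex.conj_mul', ← Complex.ofReal_pow, ← Complex.ofReal_one, ← Complex.ofReal_sub,
      Complex.norm_real, Real.norm_of_nonneg]
    nlinarith [norm_nonneg b]
  have e3 : (1 - (starRingEnd ℂ) (S z₀) * S z₀) * deriv (diskShift (S z₀) ∘ S) z₀ = deriv S z₀ := by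
    rw [e1]; field_simp
  have n2 := congrArg norm e2
  have n3 := congrArg norm e3
  rw [norm_mul, hcc _ (hS1 z₀ hz₀)] at n3
  rw [norm_mul, norm_mul, norm_mul, hcc _ ha, Complex.norm_ofNat, ← n3, ← hSn] at n2
  have hpos : 0 < 1 - ‖S z₀‖ ^ 2 := by nlinarith [norm_nonneg (S z₀), hS1 z₀ hz₀]
  rw [hsqrt, ← hSn]
  change 2 * ‖S z₀‖ * ‖deriv (diskShift (S z₀) ∘ S) z₀‖ = _
  refine mul_left_cancel₀ hpos.ne' ?_
  linear_combination n2

/-- An almost extremal map suffices, so no normal families are needed. If the derivative at `z₀`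
exceeds 2√ρ/(1 + ρ) times the supremum, omitting a value of modulus at most ρ would let the square
root trick push it beyond the supremum. -/
theorem exists_injOn_isDiskMap_closedBall_subset (hU : IsOpen U) (hc : IsPreconnected U)
    (hb : IsBounded U) (hex : IsExhaustedByFull U) (hz₀ : z₀ ∈ U) {ρ : ℝ} (hρ : 0 < ρ)
    (hρ1 : ρ < 1) :
    ∃ φ, IsDiskMap U z₀ φ ∧ InjOn φ U ∧ closedBall 0 ρ ⊆ φ '' U := by
  let V : Set ℝ := {d | ∃ φ, IsDiskMap U z₀ φ ∧ InjOn φ U ∧ ‖deriv φ z₀‖ = d}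
  obtain ⟨r, hr, hrU⟩ := Metric.isOpen_iff.1 hU z₀ hz₀
  have hbdd : BddAbove V := by
    refine ⟨1 / r, ?_⟩
    rintro _ ⟨φ, hφ, -, rfl⟩
    refine Complex.norm_deriv_le_div_of_mapsTo_ball (hφ.differentiableOn.mono hrU)
      (fun z hz => ?_) hr
    rw [hφ.map_base, mem_closedBall_zero_iff]
    exact (hφ.norm_lt_one z (hrU hz)).le
  obtain ⟨R, hR0, hR⟩ : ∃ R : ℝ, 0 < R ∧ ∀ z ∈ U, ‖z - z₀‖ < R := by
    obtain ⟨R, hR⟩ := hb.subset_ball z₀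
    exact ⟨R, pos_of_mem_ball (hR hz₀), fun z hz => by
      rw [← dist_eq_norm]; exact hR hz⟩
  have hlin : 1 / R ∈ V := by
    have hd : ∀ z : ℂ, HasDerivAt (fun z : ℂ => (z - z₀) / R) (1 / R) z := fun z =>
      ((hasDerivAt_id z).sub_const z₀).div_const _
    refine ⟨fun z => (z - z₀) / R, ⟨fun z _ => (hd z).differentiableAt.differentiableWithinAt,
      fun z hz => ?_, by simp⟩, fun v _ w _ h => ?_, ?_⟩
    · rw [norm_div, Complex.norm_real, Real.norm_of_nonneg hR0.le, div_lt_one hR0]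
      exact hR z hz
    · have : (R : ℂ) ≠ 0 := by exact_mod_cast hR0.ne'
      simp only [div_left_inj' this] at h
      exact sub_left_injective h
    · rw [(hd z₀).deriv, norm_div, norm_one, Complex.norm_real, Real.norm_of_nonneg hR0.le]
  have hM : 0 < sSup V := lt_of_lt_of_le (by positivity) (le_csSup hbdd hlin)
  have hq : 2 * √ρ / (1 + ρ) < 1 := by
    rw [div_lt_one (by linarith)]
    have h1 := Real.sq_sqrt hρ.le
    have h2 : √ρ < 1 := by rw [Real.sqrt_lt' one_pos]; linarith
    nlinarith [pow_pos (sub_pos.2 h2) 2]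
  obtain ⟨_, ⟨φ, hφ, hinj, rfl⟩, hlt⟩ := exists_lt_of_lt_csSup ⟨_, hlin⟩
    (mul_lt_of_lt_one_left hM hq)
  refine ⟨φ, hφ, hinj, fun a ha => ?_⟩
  by_contra hna
  rw [mem_closedBall_zero_iff] at ha
  have ha0 : 0 < ‖a‖ := norm_pos_iff.2 fun h => hna ⟨z₀, hz₀, hφ.map_base.trans h.symm⟩
  obtain ⟨ψ, hψ, hψinj, hψd⟩ := exists_injOn_isDiskMap_deriv hU hc hex hz₀ hφ hinj
    (ha.trans_lt hρ1) fun z hz h => hna ⟨z, hz, h⟩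
  have hle : ‖deriv ψ z₀‖ ≤ sSup V := le_csSup hbdd ⟨ψ, hψ, hψinj, rfl⟩
  rw [div_mul_eq_mul_div, div_lt_iff₀ (by linarith)] at hlt
  set s := √‖a‖
  set q := √ρ
  have hs : s ^ 2 = ‖a‖ := Real.sq_sqrt ha0.le
  have hq2 : q ^ 2 = ρ := Real.sq_sqrt hρ.le
  have hs0 : 0 < s := Real.sqrt_pos.2 ha0
  have hq0 : 0 < q := Real.sqrt_pos.2 hρ
  have hsq : s ≤ q := Real.sqrt_le_sqrt ha
  have hq1 : q < 1 := by rw [Real.sqrt_lt' one_pos]; linarith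
  -- Monotonicity of s/(1 + s²) on [0, 1]: an omitted value of smaller modulus gains at least as
  -- much.
  have hmono : (1 + q ^ 2) * s ≤ (1 + s ^ 2) * q := by
    nlinarith [mul_nonneg (sub_nonneg.2 hsq) (show 0 ≤ 1 - q * s by nlinarith)]
  rw [← hs] at hψd
  rw [← hq2] at hlt
  have h1 := mul_lt_mul_of_pos_right hlt hs0
  have h2 := mul_le_mul_of_nonneg_right hmono (norm_nonneg (deriv φ z₀))
  have h3 : 2 * s * q * sSup V < 2 * s * q * ‖deriv ψ z₀‖ := by
    calc 2 * s * q * sSup V = 2 * q * sSup V * s := by ring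
      _ < ‖deriv φ z₀‖ * (1 + q ^ 2) * s := h1
      _ = (1 + q ^ 2) * s * ‖deriv φ z₀‖ := by ring
      _ ≤ (1 + s ^ 2) * q * ‖deriv φ z₀‖ := h2
      _ = 2 * s * q * ‖deriv ψ z₀‖ := by linear_combination -q * hψd
  exact absurd (lt_of_mul_lt_mul_left h3 (by positivity)) (not_lt.2 hle)

end Koebe

/-! ### Closed topological disks -/

section Disk

/-- An injective holomorphic function is an open partial homeomorphism. -/
theorem exists_openPartialHomeomorph {U : Set ℂ} (hU : IsOpen U) (hc : IsConnected U)
    {φ : ℂ → ℂ} (hφ : DifferentiableOn ℂ φ U) (hinj : InjOn φ U) :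
    ∃ e : OpenPartialHomeomorph ℂ ℂ, e.source = U ∧ e.target = φ '' U ∧ ⇑e = φ := by
  have hne : U.Nonempty := hc.nonempty
  have hopen : ∀ s ⊆ U, IsOpen s → IsOpen (φ '' s) := by
    refine ((hφ.analyticOnNhd hU).is_constant_or_isOpen hc.isPreconnected).resolve_left ?_
    rintro ⟨w, hw⟩
    obtain ⟨z, hz⟩ := hne
    have hsub : U ⊆ {z} := fun y hy => hinj hy hz ((hw y hy).trans (hw z hz).symm)
    exact (not_isOpen_singleton z) (by rwa [hsub.antisymm (singleton_subset_iff.2 hz)] at hU)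
  have key : IsOpenMap fun x : U => φ x := fun s hs => by
    have := hopen _ (Subtype.coe_image_subset U s) (hU.isOpenMap_subtype_val s hs)
    rwa [image_image] at this
  exact ⟨OpenPartialHomeomorph.ofContinuousOpenRestrict (hinj.toPartialEquiv φ U)
    hφ.continuousOn key hU, rfl, rfl, rfl⟩

/-- The inverse of `φ`, rescaled by ρ, parametrizes the set by the closed unit disk. Since the
inverse is a homeomorphism between open sets and the disk is compactly contained in the image, the
circle goes exactly to the frontier. -/
theorem exists_boundsClosedDisk_of_closedBall_subset {U : Set ℂ} (hU : IsOpen U)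
    (hc : IsConnected U) {φ : ℂ → ℂ} (hφ : DifferentiableOn ℂ φ U) (hinj : InjOn φ U) {ρ : ℝ}
    (hρ : 0 < ρ) (hsub : closedBall 0 ρ ⊆ φ '' U) :
    ∃ γ : Circle → ℂ, BoundsClosedDisk γ {z ∈ U | ‖φ z‖ ≤ ρ} := by
  obtain ⟨e, hes, het, he⟩ := exists_openPartialHomeomorph hU hc hφ hinj
  subst hes he
  rw [← het] at hsub
  set D : Set ℂ := {z ∈ e.source | ‖e z‖ ≤ ρ} with hD
  have hDe : D = e.symm '' closedBall 0 ρ := by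
    ext z
    constructor
    · exact fun hz => ⟨e z, mem_closedBall_zero_iff.2 hz.2, e.left_inv hz.1⟩
    · rintro ⟨w, hw, rfl⟩
      refine ⟨e.map_target (hsub hw), ?_⟩
      rw [e.right_inv (hsub hw)]
      exact mem_closedBall_zero_iff.1 hw
  have hcs : ContinuousOn e.symm (closedBall 0 ρ) := e.continuousOn_symm.mono hsub
  have hDc : IsCompact D := hDe ▸ (isCompact_closedBall 0 ρ).image_of_continuousOn hcs
  have hscale : ∀ {w : ℂ}, ‖w‖ ≤ 1 → (ρ : ℂ) * w ∈ closedBall (0 : ℂ) ρ := fun {w} hw => by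
    rw [mem_closedBall_zero_iff, norm_mul, Complex.norm_real, Real.norm_of_nonneg hρ.le]
    exact mul_le_of_le_one_right hρ.le hw
  have hρ0 : (ρ : ℂ) ≠ 0 := by exact_mod_cast hρ.ne'
  refine ⟨fun u => e.symm (ρ * u), ?_, ?_, ⟨?_⟩, ?_⟩
  · exact hcs.comp_continuous (by fun_prop) fun u => hscale (Circle.norm_coe u).le
  · intro u v huv
    have h := e.symm.injOn (hsub (hscale (Circle.norm_coe u).le))
      (hsub (hscale (Circle.norm_coe v).le)) huv
    exact Circle.ext (mul_left_cancel₀ hρ0 h)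
  · exact
      { toFun := fun z => ⟨(ρ : ℂ)⁻¹ * e z, by
          rw [mem_closedBall_zero_iff, norm_mul, norm_inv, Complex.norm_real,
            Real.norm_of_nonneg hρ.le, inv_mul_le_one₀ hρ]
          exact z.2.2⟩
        invFun := fun w => ⟨e.symm (ρ * w), by
          rw [hDe]
          exact mem_image_of_mem _ (hscale (mem_closedBall_zero_iff.1 w.2))⟩
        left_inv := fun z => Subtype.ext (by
          simp only [mul_inv_cancel_left₀ hρ0]
          exact e.left_inv z.2.1)
        right_inv := fun w => Subtype.ext (by
          simp only [e.right_inv (hsub (hscale (mem_closedBall_zero_iff.1 w.2))),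
            inv_mul_cancel_left₀ hρ0])
        continuous_toFun := by
          have h1 : Continuous fun z : D => e z :=
            continuousOn_iff_continuous_domRestrict.1 (e.continuousOn.mono fun z hz => hz.1)
          exact (continuous_const.mul h1).subtype_mk _
        continuous_invFun := by
          have h1 : Continuous fun w : closedBall (0 : ℂ) 1 => e.symm (ρ * w) :=
            hcs.comp_continuous (by fun_prop) fun w => hscale (mem_closedBall_zero_iff.1 w.2)
          exact h1.subtype_mk _ }
  · have himg : e.IsImage D (closedBall 0 ρ) := fun z hz => by
      rw [mem_closedBall_zero_iff]
      exact ⟨fun h => ⟨hz, h⟩, fun h => h.2⟩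
    have hfr := himg.frontier
    rw [frontier_closedBall _ hρ.ne'] at hfr
    ext z
    constructor
    · intro hz
      have hzD : z ∈ D := hDc.isClosed.frontier_subset hz
      have h1 := mem_sphere_zero_iff_norm.1 ((hfr hzD.1).2 hz)
      refine ⟨⟨(ρ : ℂ)⁻¹ * e z, mem_sphere_zero_iff_norm.2 ?_⟩, ?_⟩
      · rw [norm_mul, norm_inv, Complex.norm_real,
          Real.norm_of_nonneg hρ.le, h1, inv_mul_cancel₀ hρ.ne']
      · simp only [mul_inv_cancel_left₀ hρ0]
        exact e.left_inv hzD.1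
    · rintro ⟨u, rfl⟩
      have hu := hsub (hscale (Circle.norm_coe u).le)
      refine (hfr (e.map_target hu)).1 ?_
      rw [e.right_inv hu, mem_sphere_zero_iff_norm, norm_mul, Complex.norm_real,
        Real.norm_of_nonneg hρ.le, Circle.norm_coe, mul_one]

/-- A compact subset of a bounded domain without holes can be enclosed in a closed topological
disk inside the domain. -/
theorem exists_boundsClosedDisk_between {U : Set ℂ} (hU : IsOpen U) (hc : IsConnected U)
    (hb : IsBounded U) (hex : IsExhaustedByFull U) {K : Set ℂ} (hK : IsCompact K) (hKU : K ⊆ U) :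
    ∃ (γ : Circle → ℂ) (D : Set ℂ), BoundsClosedDisk γ D ∧ K ⊆ interior D ∧ D ⊆ U := by
  obtain ⟨z₀, hz₀⟩ := hc.nonempty
  obtain ⟨c, hc1, hcK⟩ := exists_norm_le_of_isDiskMap hU hc.isPreconnected hz₀ hK hKU
  -- The bound `c` on `K` is uniform over all disk maps, so ρ can be fixed before `φ` is chosen.
  obtain ⟨ρ, hρ, hρ1⟩ := exists_between (max_lt hc1 one_pos)
  obtain ⟨φ, hφ, hinj, hφU⟩ := exists_injOn_isDiskMap_closedBall_subset hU hc.isPreconnected hb hex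
    hz₀ ((le_max_right _ _).trans_lt hρ) hρ1
  obtain ⟨γ, hγ⟩ := exists_boundsClosedDisk_of_closedBall_subset hU hc hφ.differentiableOn hinj
    ((le_max_right _ _).trans_lt hρ) hφU
  refine ⟨γ, _, hγ, fun z hz => ?_, fun z hz => hz.1⟩
  rw [mem_interior_iff_mem_nhds]
  have hcont := (hφ.differentiableOn.continuousOn.continuousAt (hU.mem_nhds (hKU hz))).norm
  filter_upwards [hU.mem_nhds (hKU hz), hcont.eventually_lt_const
    (((hcK φ hφ z hz).trans (le_max_left c 0)).trans_lt hρ)] with w hw hwρ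
  exact ⟨hw, hwρ.le⟩

end Disk

/-! ### The semigroup and its limit set -/

section LimitSet

variable {z : ℂ}

/-- The generator `f z` as a homeomorphism. -/
noncomputable def fHomeo (hz : z ≠ 0) : ℂ ≃ₜ ℂ := Homeomorph.mulLeft₀ z hz

/-- The generator `g z` as a homeomorphism. -/
noncomputable def gHomeo (hz : z ≠ 0) : ℂ ≃ₜ ℂ := (fHomeo hz).trans (Homeomorph.addLeft (1 - z))

theorem coe_fHomeo (hz : z ≠ 0) : ⇑(fHomeo hz) = f z := rfl

theorem coe_gHomeo (hz : z ≠ 0) : ⇑(gHomeo hz) = g z := funext fun x => by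
  change 1 - z + z * x = z * (x - 1) + 1
  ring

theorem image_g (S : Set ℂ) : g z '' S = ((1 - z) + ·) '' (f z '' S) := by
  have h : ∀ x, 1 - z + f z x = g z x := fun x => by
    change 1 - z + z * x = z * (x - 1) + 1
    ring
  ext y
  constructor
  · rintro ⟨x, hx, rfl⟩
    exact ⟨f z x, ⟨x, hx, rfl⟩, h x⟩
  · rintro ⟨_, ⟨x, hx, rfl⟩, rfl⟩
    exact ⟨x, hx, (h x).symm⟩

theorem dist_f (x y : ℂ) : dist (f z x) (f z y) = ‖z‖ * dist x y := by
  rw [dist_eq_norm, dist_eq_norm, ← norm_mul, mul_sub]; rfl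

theorem dist_g (x y : ℂ) : dist (g z x) (g z y) = ‖z‖ * dist x y := by
  rw [dist_eq_norm, dist_eq_norm, ← norm_mul]
  congr 1
  change z * (x - 1) + 1 - (z * (y - 1) + 1) = _
  ring

theorem f_ne_g (hz₁ : ‖z‖ < 1) : f z ≠ g z := fun h => by
  have h0 : z * 0 = z * (0 - 1) + 1 := congrFun h 0
  have : z = 1 := by linear_combination h0
  rw [this, norm_one] at hz₁
  exact lt_irrefl _ hz₁

theorem exists_affine_of_mem_generators {s : Function.End ℂ} (hs : s ∈ generators z) :
    ∃ b : ℂ, ∀ x, s x = z * x + b := by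
  rcases hs with rfl | rfl
  · exact ⟨0, fun x => (add_zero _).symm⟩
  · refine ⟨1 - z, fun x => ?_⟩
    change z * (x - 1) + 1 = _
    ring

theorem exists_affine_of_mem_G (hz₁ : ‖z‖ < 1) {φ : Function.End ℂ} (hφ : φ ∈ G z) :
    ∃ a b : ℂ, ‖a‖ ≤ ‖z‖ ∧ ∀ x, φ x = a * x + b := by
  induction hφ using Subsemigroup.closure_induction with
  | mem s hs =>
    obtain ⟨b, hb⟩ := exists_affine_of_mem_generators hs
    exact ⟨z, b, le_rfl, hb⟩
  | mul φ ψ _ _ h1 h2 =>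
    obtain ⟨a, b, ha, h⟩ := h1
    obtain ⟨a', b', ha', h'⟩ := h2
    refine ⟨a * a', a * b' + b, ?_, fun x => ?_⟩
    · rw [norm_mul]
      nlinarith [norm_nonneg a, norm_nonneg a', norm_nonneg z]
    · change φ (ψ x) = _
      rw [h', h]
      ring

theorem mem_generators_or_exists_mul {φ : Function.End ℂ} (hφ : φ ∈ G z) :
    φ ∈ generators z ∨ ∃ s ∈ generators z, ∃ ψ ∈ G z, φ = s * ψ := by
  induction hφ using Subsemigroup.closure_induction with
  | mem s hs => exact Or.inl hs
  | mul φ ψ _ hψ h1 _ =>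
    right
    rcases h1 with h1 | ⟨s, hs, φ', hφ', rfl⟩
    · exact ⟨φ, h1, ψ, hψ, rfl⟩
    · exact ⟨s, hs, φ' * ψ, mul_mem hφ' hψ, mul_assoc _ _ _⟩

/-- A nonempty closed set mapped to itself by the generators contains the limit set. -/
theorem limitSet_subset_of_image_subset (hz₁ : ‖z‖ < 1) {D : Set ℂ} (hD : IsClosed D)
    (hne : D.Nonempty) (hmap : ∀ s ∈ generators z, s '' D ⊆ D) : limitSet (G z) ⊆ D := by
  refine closure_minimal ?_ hD
  rintro p ⟨φ, hφ, hp⟩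
  have hφD : ∀ x ∈ D, φ x ∈ D := by
    clear hp
    induction hφ using Subsemigroup.closure_induction with
    | mem s hs => exact fun x hx => hmap s hs (mem_image_of_mem s hx)
    | mul φ ψ _ _ h1 h2 => exact fun x hx => h1 _ (h2 x hx)
  obtain ⟨a, b, ha, hab⟩ := exists_affine_of_mem_G hz₁ hφ
  obtain ⟨x, hx⟩ := hne
  -- These are the iterates of `x` under `φ`, which converge to its fixed point.
  have hn : ∀ n : ℕ, p + a ^ n * (x - p) ∈ D := by
    intro n
    induction n with
    | zero => simpa using hx
    | succ n ih =>
      have := hφD _ ih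
      rw [hab] at this
      rw [hab] at hp
      convert this using 1
      linear_combination -hp
  have hlim : Tendsto (fun n : ℕ => p + a ^ n * (x - p)) atTop (𝓝 (p + 0 * (x - p))) :=
    tendsto_const_nhds.add
      ((tendsto_pow_atTop_nhds_zero_of_norm_lt_one (ha.trans_lt hz₁)).mul_const _)
  rw [zero_mul, add_zero] at hlim
  exact hD.mem_of_tendsto hlim (Eventually.of_forall hn)

/-- The radius solves ‖z‖R + 2 = R, so the ball is invariant under both generators. -/
theorem isCompact_limitSet (hz₁ : ‖z‖ < 1) : IsCompact (limitSet (G z)) := by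
  have h1 : 0 < 1 - ‖z‖ := sub_pos.2 hz₁
  refine (isCompact_closedBall (0 : ℂ) (2 / (1 - ‖z‖))).of_isClosed_subset isClosed_closure
    (limitSet_subset_of_image_subset hz₁ isClosed_closedBall ⟨0, by simp; positivity⟩ ?_)
  rintro s hs _ ⟨x, hx, rfl⟩
  rw [mem_closedBall_zero_iff] at hx ⊢
  have hR : ‖z‖ * (2 / (1 - ‖z‖)) + 2 = 2 / (1 - ‖z‖) := by field_simp; ring
  have hzx : ‖z * x‖ ≤ ‖z‖ * (2 / (1 - ‖z‖)) := by
    rw [norm_mul]; exact mul_le_mul_of_nonneg_left hx (norm_nonneg _)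
  rcases hs with rfl | rfl
  · change ‖z * x‖ ≤ _
    linarith
  · have h2 : g z x = z * x + (1 - z) := by change z * (x - 1) + 1 = _; ring
    have h3 := norm_add_le (z * x) (1 - z)
    have h4 := norm_sub_le (1 : ℂ) z
    rw [norm_one] at h4
    rw [h2]
    linarith

theorem zero_mem_limitSet : (0 : ℂ) ∈ limitSet (G z) :=
  subset_closure ⟨f z, Subsemigroup.subset_closure (Or.inl rfl), mul_zero z⟩

theorem image_limitSet_subset (hz₁ : ‖z‖ < 1) {s : Function.End ℂ} (hs : s ∈ generators z) :
    s '' limitSet (G z) ⊆ limitSet (G z) := by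
  have hsG : s ∈ G z := Subsemigroup.subset_closure hs
  have hscont : Continuous s := by
    obtain ⟨b, hb⟩ := exists_affine_of_mem_generators hs
    rw [show (s : ℂ → ℂ) = fun x => z * x + b from funext hb]
    fun_prop
  refine (image_closure_subset_closure_image hscont).trans (closure_minimal ?_ isClosed_closure)
  rintro _ ⟨p, ⟨w, hw, hwp⟩, rfl⟩
  -- the fixed points of `s ∘ w ^ n` converge to `s p`
  have hψ : ∀ n : ℕ, ∃ ψ ∈ G z, ψ p = s p ∧ ∃ a b : ℂ, ‖a‖ ≤ ‖z‖ ^ (n + 1) ∧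
      ∀ x, ψ x = a * x + b := by
    intro n
    induction n with
    | zero =>
      obtain ⟨b, hb⟩ := exists_affine_of_mem_generators hs
      exact ⟨s, hsG, rfl, z, b, by simp, hb⟩
    | succ n ih =>
      obtain ⟨ψ, hψ, hψp, a, b, ha, hab⟩ := ih
      obtain ⟨a', b', ha', hab'⟩ := exists_affine_of_mem_G hz₁ hw
      refine ⟨ψ * w, mul_mem hψ hw, ?_, a * a', a * b' + b, ?_, fun x => ?_⟩
      · change ψ (w p) = s p
        rw [hwp, hψp]
      · rw [norm_mul, pow_succ]
        exact mul_le_mul ha ha' (norm_nonneg _) (by positivity)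
      · change ψ (w x) = _
        rw [hab', hab]
        ring
  have h1 : 0 < 1 - ‖z‖ := sub_pos.2 hz₁
  rw [limitSet, Metric.mem_closure_iff]
  intro ε hε
  have hlim : Tendsto (fun n : ℕ => ‖z‖ ^ n * (‖s p - p‖ / (1 - ‖z‖))) atTop
      (𝓝 (0 * (‖s p - p‖ / (1 - ‖z‖)))) :=
    (tendsto_pow_atTop_nhds_zero_of_lt_one (norm_nonneg z) hz₁).mul_const _
  rw [zero_mul] at hlim
  obtain ⟨n, hn⟩ := (hlim.eventually (gt_mem_nhds hε)).exists
  obtain ⟨ψ, hψG, hψp, a, b, ha, hab⟩ := hψ n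
  have ha1 : ‖a‖ ≤ ‖z‖ := ha.trans (by
    rw [pow_succ]
    exact mul_le_of_le_one_left (norm_nonneg z) (pow_le_one₀ (norm_nonneg z) hz₁.le))
  have han : ‖a‖ ≤ ‖z‖ ^ n := ha.trans (pow_le_pow_of_le_one (norm_nonneg z) hz₁.le (Nat.le_succ n))
  have hne : 1 - a ≠ 0 := fun h => by
    rw [← sub_eq_zero.1 h, norm_one] at ha1
    linarith
  refine ⟨b / (1 - a), ⟨ψ, hψG, ?_⟩, ?_⟩
  · rw [hab]
    field_simp
    ring
  · rw [dist_eq_norm]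
    refine lt_of_le_of_lt ?_ hn
    have h2 : s p - b / (1 - a) = a * (p - s p) / (1 - a) := by
      rw [← hψp, hab]
      field_simp
      ring
    have h3 : 1 - ‖z‖ ≤ ‖1 - a‖ := by
      have := norm_sub_norm_le (1 : ℂ) a
      rw [norm_one] at this
      linarith
    rw [h2, norm_div, norm_mul, norm_sub_rev p, ← mul_div_assoc]
    exact div_le_div₀ (by positivity) (mul_le_mul_of_nonneg_right han (norm_nonneg _)) h1 h3

/-- The limit set is self-similar. -/
theorem limitSet_eq_union (hz₁ : ‖z‖ < 1) :
    limitSet (G z) = f z '' limitSet (G z) ∪ g z '' limitSet (G z) := by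
  refine Subset.antisymm (closure_minimal ?_ ?_)
    (union_subset (image_limitSet_subset hz₁ (Or.inl rfl))
      (image_limitSet_subset hz₁ (Or.inr rfl)))
  · rintro p ⟨φ, hφ, hp⟩
    have key : ∃ s ∈ generators z, p ∈ s '' limitSet (G z) := by
      rcases mem_generators_or_exists_mul hφ with h | ⟨s, hs, ψ, hψ, rfl⟩
      · exact ⟨φ, h, p, subset_closure ⟨φ, hφ, hp⟩, hp⟩
      -- Conjugation by a cyclic rotation of the word: if `p` is fixed by `s * ψ`, then `ψ p` is
      -- fixed by `ψ * s` and is sent to `p` by `s`.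
      · refine ⟨s, hs, ψ p, subset_closure ⟨ψ * s,
          mul_mem hψ (Subsemigroup.subset_closure hs), ?_⟩, hp⟩
        change ψ (s (ψ p)) = ψ p
        exact congrArg ψ hp
    obtain ⟨s, rfl | rfl, h⟩ := key
    · exact Or.inl h
    · exact Or.inr h
  · have hc := isCompact_limitSet hz₁
    have hf : Continuous (f z) := continuous_const_mul z
    have hg : Continuous (g z) := ((continuous_id.sub continuous_const).const_mul z).add_const 1
    exact (hc.image hf).isClosed.union (hc.image hg).isClosed

end LimitSet

/-! ### Thickenings of the limit set -/

section Thickening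

theorem image_cthickening {E : Type*} [PseudoMetricSpace E] [ProperSpace E] (e : E ≃ₜ E) {r : ℝ}
    (hr : 0 < r) (he : ∀ x y, dist (e x) (e y) = r * dist x y) {A : Set E} (hA : IsCompact A)
    {s : ℝ} (hs : 0 ≤ s) : e '' cthickening s A = cthickening (r * s) (e '' A) := by
  rw [hA.cthickening_eq_biUnion_closedBall hs,
    (hA.image e.continuous).cthickening_eq_biUnion_closedBall (by positivity)]
  ext y
  obtain ⟨x, rfl⟩ := e.surjective y
  rw [e.injective.mem_set_image]
  simp only [mem_iUnion₂, mem_closedBall, exists_prop, exists_mem_image, he, mul_le_mul_iff_right₀ hr]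

/-- A compact set is connected if all its closed thickenings are. -/
theorem isPreconnected_of_cthickening {E : Type*} [MetricSpace E] {A : Set E}
    (hA : IsCompact A) (h : ∀ s > 0, IsPreconnected (cthickening s A)) :
    IsPreconnected A := by
  rw [isPreconnected_closed_iff]
  rintro P Q hP hQ hPQ ⟨x, hxA, hxP⟩ ⟨y, hyA, hyQ⟩
  by_contra hne
  rw [not_nonempty_iff_eq_empty] at hne
  have hd : Disjoint (A ∩ P) (A ∩ Q) := disjoint_left.2 fun w hw hw' => by
    rw [← mem_empty_iff_false w, ← hne]
    exact ⟨hw.1, hw.2, hw'.2⟩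
  obtain ⟨V, W, hV, hW, hPV, hQW, hVW⟩ :=
    SeparatedNhds.of_isCompact_isCompact (hA.inter_right hP) (hA.inter_right hQ) hd
  have hsub : A ⊆ V ∪ W := fun w hw =>
    (hPQ hw).imp (fun h => hPV ⟨hw, h⟩) fun h => hQW ⟨hw, h⟩
  obtain ⟨s, hs, hsVW⟩ := hA.exists_cthickening_subset_open (hV.union hW) hsub
  obtain ⟨w, -, hw⟩ := h s hs V W hV hW hsVW
    ⟨x, self_subset_cthickening A hxA, hPV ⟨hxA, hxP⟩⟩
    ⟨y, self_subset_cthickening A hyA, hQW ⟨hyA, hyQ⟩⟩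
  exact hVW.le_bot hw

variable {z : ℂ}

theorem image_f_cthickening (hz₀ : z ≠ 0) {A : Set ℂ} (hA : IsCompact A) {s : ℝ} (hs : 0 ≤ s) :
    f z '' cthickening s A = cthickening (‖z‖ * s) (f z '' A) :=
  image_cthickening (fHomeo hz₀) (norm_pos_iff.2 hz₀) dist_f hA hs

theorem image_g_cthickening (hz₀ : z ≠ 0) {A : Set ℂ} (hA : IsCompact A) {s : ℝ} (hs : 0 ≤ s) :
    g z '' cthickening s A = cthickening (‖z‖ * s) (g z '' A) := by
  have h := image_cthickening (gHomeo hz₀) (norm_pos_iff.2 hz₀)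
    (fun x y => by rw [coe_gHomeo]; exact dist_g x y) hA hs
  rwa [coe_gHomeo] at h

/-- The closed `s`-thickening of the limit set is connected as soon as `2 * s` is at least the
distance between its two pieces. -/
theorem isPreconnected_cthickening_limitSet (hz₀ : z ≠ 0) (hz₁ : ‖z‖ < 1) {a b : ℂ}
    (ha : a ∈ f z '' limitSet (G z)) (hb : b ∈ g z '' limitSet (G z)) {s : ℝ} (hs : 0 < s)
    (hab : dist a b ≤ 2 * s) : IsPreconnected (cthickening s (limitSet (G z))) := by
  have hc := isCompact_limitSet hz₁
  have hzn : 0 < ‖z‖ := norm_pos_iff.2 hz₀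
  obtain ⟨R, hR⟩ := hc.isBounded.exists_norm_le
  -- Induction on scale. For `s ≥ R` all the balls share the origin. For smaller `s`, the generators
  -- send the connected thickening of radius `s / ‖z‖` to the `s`-thickenings of the two pieces,
  -- which share the midpoint of `a` and `b`.
  have key : ∀ n : ℕ, ∀ s : ℝ, 0 < s → dist a b ≤ 2 * s → R * ‖z‖ ^ n ≤ s →
      IsPreconnected (cthickening s (limitSet (G z))) := by
    intro n
    induction n with
    | zero =>
      intro s hs _ hRs
      rw [pow_zero, mul_one] at hRs
      rw [hc.cthickening_eq_biUnion_closedBall hs.le, biUnion_eq_iUnion]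
      exact isPreconnected_iUnion ⟨0, mem_iInter.2 fun x => by
        rw [mem_closedBall, dist_comm, dist_zero_right]
        exact (hR x x.2).trans hRs⟩ fun x => (convex_closedBall _ _).isPreconnected
    | succ n ih =>
      intro s hs hab hRs
      have h1 : s ≤ s / ‖z‖ := le_div_self hs.le hzn hz₁.le
      have hpre := ih (s / ‖z‖) (by positivity) (by linarith) (by
        rw [le_div_iff₀ hzn, mul_assoc, ← pow_succ]; exact hRs)
      have hs' : 0 ≤ s / ‖z‖ := by positivity
      have hmul : ‖z‖ * (s / ‖z‖) = s := mul_div_cancel₀ s hzn.ne'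
      have hF := hpre.image (f z) (fHomeo hz₀).continuous.continuousOn
      have hG := hpre.image (gHomeo hz₀) (gHomeo hz₀).continuous.continuousOn
      rw [coe_gHomeo, image_g_cthickening hz₀ hc hs', hmul] at hG
      rw [image_f_cthickening hz₀ hc hs', hmul] at hF
      rw [limitSet_eq_union hz₁, cthickening_union]
      refine hF.union (midpoint ℝ a b) ?_ ?_ hG
      · refine mem_cthickening_of_dist_le _ a _ _ ha ?_
        rw [dist_midpoint_left, Real.norm_ofNat]
        linarith
      · refine mem_cthickening_of_dist_le _ b _ _ hb ?_
        rw [dist_midpoint_right, Real.norm_ofNat]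
        linarith
  have hlim : Tendsto (fun n : ℕ => R * ‖z‖ ^ n) atTop (𝓝 (R * 0)) :=
    (tendsto_pow_atTop_nhds_zero_of_lt_one hzn.le hz₁).const_mul R
  rw [mul_zero] at hlim
  obtain ⟨n, hn⟩ := (hlim.eventually (gt_mem_nhds hs)).exists
  exact key n s hs hab hn.le

/-- A common point is the case `a = b` of the previous criterion: every positive thickening would be
connected, hence also the limit set. -/
theorem disjoint_image_limitSet (hz₀ : z ≠ 0) (hz₁ : ‖z‖ < 1)
    (h : ¬ IsConnected (limitSet (G z))) :
    Disjoint (f z '' limitSet (G z)) (g z '' limitSet (G z)) := by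
  refine disjoint_left.2 fun a ha hb => h ⟨⟨0, zero_mem_limitSet⟩, ?_⟩
  refine isPreconnected_of_cthickening (isCompact_limitSet hz₁) fun s hs =>
    isPreconnected_cthickening_limitSet hz₀ hz₁ ha hb hs ?_
  rw [dist_self]
  positivity

/-- The filled closed thickening of the limit set. -/
noncomputable def filledThickening (z : ℂ) (s : ℝ) : Set ℂ :=
  fill (cthickening s (limitSet (G z)))

theorem filledThickening_mono {s t : ℝ} (h : s ≤ t) :
    filledThickening z s ⊆ filledThickening z t := fill_mono (cthickening_mono h _)

theorem isCompact_filledThickening (hz₁ : ‖z‖ < 1) (s : ℝ) : IsCompact (filledThickening z s) :=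
  isCompact_fill (isCompact_limitSet hz₁).cthickening

theorem filledThickening_subset_interior {s t : ℝ} (ht : 0 < t) (h : s < t) :
    filledThickening z s ⊆ interior (filledThickening z t) :=
  fill_subset_interior_fill isClosed_cthickening
    ((cthickening_subset_thickening' ht h _).trans
      (interior_maximal (thickening_subset_cthickening t _) isOpen_thickening))

theorem zero_mem_filledThickening (s : ℝ) : (0 : ℂ) ∈ filledThickening z s :=
  subset_fill _ (self_subset_cthickening _ zero_mem_limitSet)

theorem image_f_filledThickening (hz₀ : z ≠ 0) (hz₁ : ‖z‖ < 1) {s : ℝ} (hs : 0 ≤ s) :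
    f z '' filledThickening z s = fill (cthickening (‖z‖ * s) (f z '' limitSet (G z))) := by
  rw [← image_f_cthickening hz₀ (isCompact_limitSet hz₁) hs]
  exact image_fill (fHomeo hz₀) _

theorem image_g_filledThickening (hz₀ : z ≠ 0) (hz₁ : ‖z‖ < 1) {s : ℝ} (hs : 0 ≤ s) :
    g z '' filledThickening z s = fill (cthickening (‖z‖ * s) (g z '' limitSet (G z))) := by
  rw [← image_g_cthickening hz₀ (isCompact_limitSet hz₁) hs]
  have h := image_fill (gHomeo hz₀) (cthickening s (limitSet (G z)))
  rwa [coe_gHomeo] at h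

theorem image_filledThickening_subset (hz₀ : z ≠ 0) (hz₁ : ‖z‖ < 1) {s t : ℝ} (hs : 0 ≤ s)
    (h : ‖z‖ * s ≤ t) {φ : Function.End ℂ} (hφ : φ ∈ generators z) :
    φ '' filledThickening z s ⊆ filledThickening z t := by
  have key : φ '' filledThickening z s = fill (cthickening (‖z‖ * s) (φ '' limitSet (G z))) := by
    rcases hφ with rfl | rfl
    · exact image_f_filledThickening hz₀ hz₁ hs
    · exact image_g_filledThickening hz₀ hz₁ hs
  rw [key]
  exact fill_mono ((cthickening_mono h _).trans
    (cthickening_subset_of_subset _ (image_limitSet_subset hz₁ hφ)))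

/-- The unfilled images are separated because `f` and `g` shrink the thickening to radius less than
`d / 2`. They are connected and translates of each other, so filling cannot make them meet. -/
theorem disjoint_image_filledThickening (hz₀ : z ≠ 0) (hz₁ : ‖z‖ < 1) {d : ℝ}
    (hd : ∀ x ∈ f z '' limitSet (G z), ∀ y ∈ g z '' limitSet (G z), d ≤ dist x y) {s : ℝ}
    (hs : 0 ≤ s) (hsd : 2 * (‖z‖ * s) < d) (hconn : IsPreconnected (cthickening s (limitSet (G z)))) :
    Disjoint (f z '' filledThickening z s) (g z '' filledThickening z s) := by
  have hc := isCompact_limitSet hz₁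
  have hA : IsConnected (f z '' cthickening s (limitSet (G z))) :=
    ⟨⟨_, mem_image_of_mem _ (self_subset_cthickening _ zero_mem_limitSet)⟩,
      hconn.image _ (fHomeo hz₀).continuous.continuousOn⟩
  have hAc : IsCompact (f z '' cthickening s (limitSet (G z))) :=
    hc.cthickening.image (fHomeo hz₀).continuous
  have hdis : Disjoint (f z '' cthickening s (limitSet (G z)))
      (g z '' cthickening s (limitSet (G z))) := by
    rw [hc.cthickening_eq_biUnion_closedBall hs]
    refine disjoint_left.2 ?_
    rintro _ ⟨x, hx, rfl⟩ ⟨y, hy, hxy⟩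
    simp only [mem_iUnion₂, mem_closedBall, exists_prop] at hx hy
    obtain ⟨x', hx', hxx⟩ := hx
    obtain ⟨y', hy', hyy⟩ := hy
    have h1 := hd _ (mem_image_of_mem _ hx') _ (mem_image_of_mem _ hy')
    have h2 := dist_triangle (f z x') (f z x) (g z y')
    rw [← hxy, dist_g, hxy, dist_f, dist_comm x' x] at h2
    have h3 := mul_le_mul_of_nonneg_left hxx (norm_nonneg z)
    have h4 := mul_le_mul_of_nonneg_left hyy (norm_nonneg z)
    linarith
  rw [image_g] at hdis
  have := disjoint_fill_of_translate hAc hA hdis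
  rw [← image_g, image_f_cthickening hz₀ hc hs, image_g_cthickening hz₀ hc hs,
    ← image_f_filledThickening hz₀ hz₁ hs, ← image_g_filledThickening hz₀ hz₁ hs] at this
  exact this

theorem isSchottky_of_not_isConnected (hz₀ : z ≠ 0) (hz₁ : ‖z‖ < 1)
    (h : ¬ IsConnected (limitSet (G z))) : IsSchottky (generators z) := by
  have hzn : 0 < ‖z‖ := norm_pos_iff.2 hz₀
  have hc := isCompact_limitSet hz₁
  have hdisj := disjoint_image_limitSet hz₀ hz₁ h
  have hne : (limitSet (G z)).Nonempty := ⟨0, zero_mem_limitSet⟩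
  obtain ⟨⟨a, b⟩, ⟨ha, hb⟩, hmin⟩ := ((hc.image (fHomeo hz₀).continuous).prod
    (hc.image (gHomeo hz₀).continuous)).exists_isMinOn
    ((hne.image _).prod (hne.image _)) (f := fun p : ℂ × ℂ => dist p.1 p.2) continuous_dist.continuousOn
  rw [coe_gHomeo] at hb hmin
  rw [coe_fHomeo] at ha hmin
  set d := dist a b with hd_def
  have hd : 0 < d := dist_pos.2 fun hab => hdisj.le_bot ⟨ha, by rw [show a = b from hab]; exact hb⟩
  have hdmin : ∀ x ∈ f z '' limitSet (G z), ∀ y ∈ g z '' limitSet (G z), d ≤ dist x y :=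
    fun x hx y hy => hmin (mk_mem_prod hx hy)
  have hconn : ∀ s, d / 2 ≤ s → IsPreconnected (cthickening s (limitSet (G z))) := fun s hs =>
    isPreconnected_cthickening_limitSet hz₀ hz₁ ha hb (by linarith) (by linarith)
  -- Since `‖z‖ < 1` there is room above `d / 2`. The bound `r * ‖z‖ < d / 2` serves twice: it
  -- separates the images and sends `U` into the `d / 2` filling.
  obtain ⟨r, hr1, hr2⟩ : ∃ r, d / 2 < r ∧ r < d / 2 / ‖z‖ :=
    exists_between ((lt_div_iff₀ hzn).2 (mul_lt_of_lt_one_right (half_pos hd) hz₁))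
  rw [lt_div_iff₀ hzn] at hr2
  -- Excluding the radius `r` makes the union open: each filling lies in the interior of any larger
  -- one.
  set U : Set ℂ := ⋃ s : Ico (d / 2) r, filledThickening z s with hUdef
  have hmemU : ∀ {x : ℂ}, x ∈ U ↔ ∃ s, d / 2 ≤ s ∧ s < r ∧ x ∈ filledThickening z s := by
    intro x
    simp [hUdef, and_assoc]
  have hcover : ∀ s, d / 2 ≤ s → s < r → filledThickening z s ⊆ U := fun s h1 h2 x hx =>
    hmemU.2 ⟨s, h1, h2, hx⟩
  have hUint : ∀ x ∈ U, ∃ s : Ico (d / 2) r, x ∈ interior (filledThickening z s) := by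
    intro x hx
    obtain ⟨s, h1, h2, hxs⟩ := hmemU.1 hx
    obtain ⟨t, ht1, ht2⟩ := exists_between h2
    exact ⟨⟨t, by linarith, ht2⟩, filledThickening_subset_interior (by linarith) ht1 hxs⟩
  have hUo : IsOpen U := isOpen_iff_mem_nhds.2 fun x hx => by
    obtain ⟨s, hs⟩ := hUint x hx
    exact mem_of_superset (mem_interior_iff_mem_nhds.1 hs) (hcover s s.2.1 s.2.2)
  have hUc : IsConnected U :=
    ⟨⟨0, hmemU.2 ⟨d / 2, le_rfl, hr1, zero_mem_filledThickening _⟩⟩,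
      isPreconnected_iUnion ⟨0, mem_iInter.2 fun s => zero_mem_filledThickening _⟩ fun s =>
        isPreconnected_fill isClosed_cthickening (hconn s s.2.1)⟩
  have hUb : IsBounded U := (isCompact_filledThickening hz₁ r).isBounded.subset fun x hx => by
    obtain ⟨s, -, h2, hxs⟩ := hmemU.1 hx
    exact filledThickening_mono h2.le hxs
  have hUex : IsExhaustedByFull U := fun C hCU hC => by
    have : Nonempty (Ico (d / 2) r) := ⟨⟨d / 2, le_rfl, hr1⟩⟩
    obtain ⟨s, hs⟩ := hC.elim_directed_cover
      (fun s : Ico (d / 2) r => interior (filledThickening z s)) (fun _ => isOpen_interior)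
      (fun x hx => mem_iUnion.2 (hUint x (hCU hx)))
      (Monotone.directed_le fun s t hst => interior_mono (filledThickening_mono hst))
    exact ⟨filledThickening z s, isCompact_filledThickening hz₁ s, hs.trans interior_subset,
      hcover s s.2.1 s.2.2, (fill_fill _).subset⟩
  obtain ⟨γ, D, hD, hKD, hDU⟩ := exists_boundsClosedDisk_between hUo hUc hUb hUex
    (isCompact_filledThickening hz₁ (d / 2)) (hcover _ le_rfl hr1)
  have hfg : Disjoint (f z '' D) (g z '' D) := by
    refine disjoint_left.2 ?_
    rintro _ ⟨x, hx, rfl⟩ ⟨y, hy, hxy⟩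
    obtain ⟨s, hs1, hs2, hxs⟩ := hmemU.1 (hDU hx)
    obtain ⟨t, ht1, ht2, hyt⟩ := hmemU.1 (hDU hy)
    have hm : max s t < r := max_lt hs2 ht2
    have hm' : d / 2 ≤ max s t := hs1.trans (le_max_left _ _)
    refine (disjoint_image_filledThickening hz₀ hz₁ hdmin (s := max s t) (by linarith)
      (by nlinarith) (hconn _ hm')).le_bot
      ⟨mem_image_of_mem _ (filledThickening_mono (le_max_left _ _) hxs), ?_⟩
    rw [← hxy]
    exact mem_image_of_mem _ (filledThickening_mono (le_max_right _ _) hyt)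
  refine ⟨D, ⟨γ, hD⟩, fun φ hφ => ?_, ?_⟩
  -- The disk lies in `U`, so its image lies in the `d / 2` filling, which is in the interior of
  -- `D`.
  · refine Subset.trans ?_ hKD
    rintro _ ⟨x, hx, rfl⟩
    obtain ⟨s, hs1, hs2, hxs⟩ := hmemU.1 (hDU hx)
    exact image_filledThickening_subset hz₀ hz₁ (by linarith) (by nlinarith) hφ
      (mem_image_of_mem _ hxs)
  · rintro s (rfl | rfl) t (rfl | rfl) hst
    · exact absurd rfl hst
    · exact hfg
    · exact hfg.symm
    · exact absurd rfl hst

theorem limitSet_subset_of_isGoodDisk (hz₁ : ‖z‖ < 1) {D : Set ℂ}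
    (hD : IsGoodDisk (generators z) D) : limitSet (G z) ⊆ D := by
  obtain ⟨⟨γ, hγ⟩, hint, -⟩ := hD
  obtain ⟨e⟩ := hγ.homeomorphic_disk
  have : CompactSpace (closedBall (0 : ℂ) 1) :=
    isCompact_iff_compactSpace.1 (isCompact_closedBall 0 1)
  have : CompactSpace D := e.symm.compactSpace
  have hDc : IsCompact D := isCompact_iff_compactSpace.2 this
  exact limitSet_subset_of_image_subset hz₁ hDc.isClosed
    ⟨_, (e.symm ⟨0, mem_closedBall_self zero_le_one⟩).2⟩
    fun s hs => (hint s hs).trans interior_subset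

theorem not_isConnected_of_isGoodDisk (hz₀ : z ≠ 0) (hz₁ : ‖z‖ < 1) {D : Set ℂ}
    (hD : IsGoodDisk (generators z) D) : ¬ IsConnected (limitSet (G z)) := by
  intro hconn
  have hsub := limitSet_subset_of_isGoodDisk hz₁ hD
  have hdisj := hD.2.2 (f z) (Or.inl rfl) (g z) (Or.inr rfl) (f_ne_g hz₁)
  have hc := isCompact_limitSet hz₁
  have hg := (hc.image (gHomeo hz₀).continuous).isClosed
  rw [coe_gHomeo] at hg
  obtain ⟨w, -, hw1, hw2⟩ := isPreconnected_closed_iff.1 hconn.isPreconnected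
    (f z '' limitSet (G z)) (g z '' limitSet (G z))
    (hc.image (fHomeo hz₀).continuous).isClosed hg (limitSet_eq_union hz₁).subset
    ⟨f z 0, image_limitSet_subset hz₁ (Or.inl rfl) (mem_image_of_mem _ zero_mem_limitSet),
      mem_image_of_mem _ zero_mem_limitSet⟩
    ⟨g z 0, image_limitSet_subset hz₁ (Or.inr rfl) (mem_image_of_mem _ zero_mem_limitSet),
      mem_image_of_mem _ zero_mem_limitSet⟩
  exact hdisj.le_bot ⟨image_mono hsub hw1, image_mono hsub hw2⟩

end Thickening

end SchottkySimilarity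

theorem mainTheorem2 (z : ℂ) (hz₀ : 0 < ‖z‖) (hz₁ : ‖z‖ < 1) :
    (¬ IsConnected (SchottkySimilarity.limitSet (SchottkySimilarity.G z)) ↔
      SchottkySimilarity.IsSchottky (SchottkySimilarity.generators z)) ∧
    (∀ D : Set ℂ, SchottkySimilarity.IsGoodDisk (SchottkySimilarity.generators z) D →
      SchottkySimilarity.limitSet (SchottkySimilarity.G z) ⊆ D) :=
  have hz : z ≠ 0 := norm_pos_iff.1 hz₀
  ⟨⟨SchottkySimilarity.isSchottky_of_not_isConnected hz hz₁,
    fun ⟨_, hD⟩ => SchottkySimilarity.not_isConnected_of_isGoodDisk hz hz₁ hD⟩,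
    fun _ hD => SchottkySimilarity.limitSet_subset_of_isGoodDisk hz₁ hD⟩
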